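/- Let $K$ be a unital commutative $\mathbb Q$-algebra, $z=(z_1,\dots,z_n)$ either commuting or noncommuting free variables, and $t$ a formal parameter commuting with everything. Let $K\langle\langle z\rangle\rangle$ and $K[[t]]\langle\langle z\rangle\rangle$ be the algebras of formal power series in $z$ over $K$ and $K[[t]]$, and let $o(u)$ denote the order of $u$ in $z$. For $\vec u=(u_1,\dots,u_n)$ let $[\vec u\,\partial/\partial z]$ be the derivation with $z_i\mapsto u_i$ for all $i$ (over $K$, resp. $K[[t]]$). For an integer $\alpha\ge 1$, let $\mathcal Der^{[\alpha]}\langle\langle z\rangle\rangle$ be the set of $K$-derivations of $K\langle\langle z\rangle\rangle$ that increase the degree in $z$ by at least $\alpha-1$, and let $\mathcal D^{[\alpha]}\langle\langle z\rangle\rangle$ be the unital $K$-subalgebra of $\mathrm{End}_K(K\langle\langle z\rangle\rangle)$ generated by it. Elements of $\mathcal D^{[\alpha]}\langle\langle z\rangle\rangle[[t]]$ act on $K[[t]]\langle\langle z\rangle\rangle$ by $\big(\sum_i t^iP_i\big)\big(\sum_j t^ju_j\big)=\sum_{i,j}t^{i+j}P_iu_j$. Let $\mathbb A_t^{[\alpha]}\langle\langle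 z\rangle\rangle$ be the set of $K[[t]]$-algebra automorphisms of $K[[t]]\langle\langle z\rangle\rangle$ of the form $F_t(z)=z-H_t(z)$ (that is, $u\mapsto u(F_t)$) with $o(H_t)\ge\alpha$ and $H_{t=0}=0$; write the inverse as $G_t(z)=z+M_t(z)$. **Theorem.** Let $\alpha\ge1$ and $F_t\in\mathbb A_t^{[\alpha]}\langle\langle z\rangle\rangle$. There is exactly one $5$-tuple $\Omega_{F_t}=(f(t),g(t),d(t),h(t),m(t))$ of elements of $\mathcal D^{[\alpha]}\langle\langle z\rangle\rangle[[t]]$, with the coefficients of $d(t),h(t),m(t)$ lying in $\mathcal Der^{[\alpha]}\langle\langle z\rangle\rangle$, such that, as operators on $K[[t]]\langle\langle z\rangle\rangle$, - $f(-t)\,u=u(F_t)$ and $g(t)\,u=u(G_t)$ for all $u\in K[[t]]\langle\langle z\rangle\rangle$; - $d(t)=-[a_t\,\partial/\partial z]$, where $a_t\in K[[t]]\langle\langle z\rangle\rangle^{n}$ satisfies $a_{t=0}=0$, $o(a_t)\ge\alpha$ and $e^{[a_t\,\partial/\partial z]}z=F_t(z)$ ($a_t$ is the D-Log of $F_t$);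 - $h(t)=\big[\tfrac{\partial M_t}{\partial t}(F_t)\,\tfrac{\partial}{\partial z}\big]$ and $m(t)=\big[\tfrac{\partial H_t}{\partial t}(G_t)\,\tfrac{\partial}{\partial z}\big]$. This $5$-tuple is an NCS system over $\mathcal D^{[\alpha]}\langle\langle z\rangle\rangle$, i.e. $$f(0)=1,\qquad f(-t)g(t)=g(t)f(-t)=1,\qquad e^{d(t)}=g(t),\qquad \frac{dg(t)}{dt}=g(t)h(t),\qquad \frac{dg(t)}{dt}=m(t)g(t).$$ This holds both for commuting and for noncommuting $z$. -/

import Mathlib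

open scoped PowerSeries Nat

/-! ### Formal power series in noncommuting variables -/

/-- `NCPowerSeries σ R` is the type of formal power series in noncommuting variables indexed by
`σ`, with coefficients in `R`: a coefficient for every word (a list of letters in `σ`). -/
def NCPowerSeries (σ R : Type*) : Type _ := List σ → R

namespace NCPowerSeries

variable {σ R : Type*} [CommRing R]

instance : AddCommGroup (NCPowerSeries σ R) := inferInstanceAs (AddCommGroup (List σ → R))

instance : Module R (NCPowerSeries σ R) := inferInstanceAs (Module R (List σ → R))

/-- The empty word has coefficient `1`, all other words have coefficient `0`. -/
instance : One (NCPowerSeries σ R) := ⟨fun w => match w with | [] => 1 | _ :: _ => 0⟩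

/-- Cauchy product: the sum over all ways of cutting the word `w` into two consecutive words. -/
instance : Mul (NCPowerSeries σ R) :=
  ⟨fun f g w => ∑ i ∈ Finset.range (w.length + 1), f (w.take i) * g (w.drop i)⟩

/-- The variable `z_i`, that is, the one-letter word `i`. -/
def X [DecidableEq σ] (i : σ) : NCPowerSeries σ R := fun w => if w = [i] then 1 else 0

/-- The series whose coefficient at `w` is the coefficient of `f` at `a :: w`. -/
def tail (a : σ) (f : NCPowerSeries σ R) : NCPowerSeries σ R := fun w => f (a :: w)

theorem zero_apply (w : List σ) : (0 : NCPowerSeries σ R) w = 0 := rfl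

theorem add_apply (f g : NCPowerSeries σ R) (w : List σ) : (f + g) w = f w + g w := rfl

theorem smul_apply (r : R) (f : NCPowerSeries σ R) (w : List σ) : (r • f) w = r * f w := rfl

theorem mul_apply (f g : NCPowerSeries σ R) (w : List σ) :
    (f * g) w = ∑ i ∈ Finset.range (w.length + 1), f (w.take i) * g (w.drop i) := rfl

theorem one_nil : (1 : NCPowerSeries σ R) [] = 1 := rfl

theorem tail_one (a : σ) : tail a (1 : NCPowerSeries σ R) = 0 := rfl

theorem tail_add (a : σ) (f g : NCPowerSeries σ R) : tail a (f + g) = tail a f + tail a g := rfl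

theorem tail_smul (a : σ) (r : R) (f : NCPowerSeries σ R) : tail a (r • f) = r • tail a f := rfl

theorem mul_nil (f g : NCPowerSeries σ R) : (f * g) [] = f [] * g [] := by
  simp [mul_apply]

theorem mul_cons (f g : NCPowerSeries σ R) (a : σ) (w : List σ) :
    (f * g) (a :: w) = f [] * g (a :: w) + (tail a f * g) w := by
  rw [mul_apply, mul_apply, List.length_cons, Finset.sum_range_succ', add_comm]
  rfl

theorem tail_mul (a : σ) (f g : NCPowerSeries σ R) :
    tail a (f * g) = f [] • tail a g + tail a f * g :=
  funext fun w => mul_cons f g a w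

protected theorem add_mul (f g h : NCPowerSeries σ R) : (f + g) * h = f * h + g * h := by
  funext w
  simp only [add_apply, mul_apply, _root_.add_mul, Finset.sum_add_distrib]

protected theorem mul_add (f g h : NCPowerSeries σ R) : f * (g + h) = f * g + f * h := by
  funext w
  simp only [add_apply, mul_apply, _root_.mul_add, Finset.sum_add_distrib]

protected theorem zero_mul (f : NCPowerSeries σ R) : 0 * f = 0 := by
  funext w
  simp [zero_apply, mul_apply]

protected theorem mul_zero (f : NCPowerSeries σ R) : f * 0 = 0 := by
  funext w
  simp [zero_apply, mul_apply]

protected theorem smul_mul (r : R) (f g : NCPowerSeries σ R) : (r • f) * g = r • (f * g) := by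
  funext w
  simp only [smul_apply, mul_apply, Finset.mul_sum, mul_assoc]

protected theorem mul_smul (r : R) (f g : NCPowerSeries σ R) : f * (r • g) = r • (f * g) := by
  funext w
  simp only [smul_apply, mul_apply, Finset.mul_sum, mul_left_comm]

protected theorem one_mul (f : NCPowerSeries σ R) : 1 * f = f := by
  funext w
  cases w with
  | nil => rw [mul_nil, one_nil, _root_.one_mul]
  | cons a w => rw [mul_cons, one_nil, tail_one, NCPowerSeries.zero_mul, _root_.one_mul,
      zero_apply, add_zero]

protected theorem mul_one (f : NCPowerSeries σ R) : f * 1 = f := by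
  funext w
  induction w generalizing f with
  | nil => rw [mul_nil, one_nil, _root_.mul_one]
  | cons a w ih =>
    rw [mul_cons, ih]
    change f [] * 0 + f (a :: w) = f (a :: w)
    ring

protected theorem mul_assoc (f g h : NCPowerSeries σ R) : f * g * h = f * (g * h) := by
  funext w
  induction w generalizing f g with
  | nil => simp only [mul_nil, _root_.mul_assoc]
  | cons a w ih =>
    rw [mul_cons, mul_cons f, mul_cons g, tail_mul, NCPowerSeries.add_mul, add_apply, ih,
      NCPowerSeries.smul_mul, smul_apply, mul_nil]
    ring

instance : Ring (NCPowerSeries σ R) :=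
  { (inferInstance : AddCommGroup (NCPowerSeries σ R)) with
    mul := (· * ·)
    one := 1
    left_distrib := NCPowerSeries.mul_add
    right_distrib := NCPowerSeries.add_mul
    zero_mul := NCPowerSeries.zero_mul
    mul_zero := NCPowerSeries.mul_zero
    mul_assoc := NCPowerSeries.mul_assoc
    one_mul := NCPowerSeries.one_mul
    mul_one := NCPowerSeries.mul_one }

instance : Algebra R (NCPowerSeries σ R) :=
  Algebra.ofModule NCPowerSeries.smul_mul fun r f g => NCPowerSeries.mul_smul r f g

end NCPowerSeries

/-! ### A common notation for the commutative and the noncommutative case -/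

/-- Notation class that lets the definitions below be written once for power series in `n`
commuting variables (`MvPowerSeries (Fin n) R`, monomials = exponent vectors) and once for power
series in `n` noncommuting variables (`NCPowerSeries (Fin n) R`, monomials = words). It is used
only for these two types, through the two instances below. -/
class FormalSeries (W : outParam Type) (n : outParam ℕ) (R : outParam Type*) (A : Type*) where
  /-- a series is the same thing as the family of its coefficients -/
  coeffs : A ≃ (W → R)
  /-- the degree of a monomial -/
  deg : W → ℕ
  /-- the variables `z_1, …, z_n` -/
  var : Fin n → A

noncomputable instance (n : ℕ) (R : Type*) [CommRing R] :
    FormalSeries (Fin n →₀ ℕ) n R (MvPowerSeries (Fin n) R) where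
  coeffs := Equiv.refl _
  deg w := w.degree
  var := MvPowerSeries.X

instance (n : ℕ) (R : Type*) [CommRing R] :
    FormalSeries (List (Fin n)) n R (NCPowerSeries (Fin n) R) where
  coeffs := Equiv.refl _
  deg := List.length
  var := NCPowerSeries.X

namespace FormalSeries

section Order

variable {W : Type} {n : ℕ} {R A : Type*} [CommRing R] [Ring A] [Algebra R A]
  [FormalSeries W n R A]

/-- `o(u) ≥ k`: all monomials of degree less than `k` have coefficient zero in `u`. -/
def OrderGE (k : ℕ) (u : A) : Prop := ∀ w : W, deg A w < k → coeffs u w = 0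

/-- The `R`-linear map `δ` is an `R`-derivation of the (not necessarily commutative) algebra. -/
def IsDerivation (δ : Module.End R A) : Prop := ∀ u v : A, δ (u * v) = δ u * v + u * δ v

/-- `δ = [u ∂/∂z]`: the derivation `δ` that maps `z_i` to `u_i` for all `i`. -/
def IsVectorField (u : Fin n → A) (δ : Module.End R A) : Prop :=
  IsDerivation δ ∧ ∀ i, δ (var i) = u i

variable (R A) in
/-- The set of all derivations that increase the degree in `z` by at least `α - 1`
(used for `α ≥ 1`). -/
def derGE (α : ℕ) : Set (Module.End R A) :=
  {δ | IsDerivation δ ∧ ∀ (k : ℕ) (u : A), OrderGE k u → OrderGE (k + (α - 1)) (δ u)}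

variable (R A) in
/-- The algebra of differential operators that increase the degree in `z` by at least `α - 1`:
the unital subalgebra of the algebra of linear endomorphisms generated by `derGE R A α`. -/
def diffOp (α : ℕ) : Subalgebra R (Module.End R A) := Algebra.adjoin R (derGE R A α)

end Order

end FormalSeries

/-! ### NCS systems -/

/-- A 5-tuple of formal power series in a central parameter `t` over `A`. -/
structure NCSTuple (A : Type*) [Ring A] where
  f : A⟦X⟧
  g : A⟦X⟧
  d : A⟦X⟧
  h : A⟦X⟧
  m : A⟦X⟧

namespace NCSTuple

section

variable {A : Type*} [Ring A]

/-- `p(-t)`. -/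
noncomputable def negT (p : A⟦X⟧) : A⟦X⟧ :=
  PowerSeries.mk fun k => (-1) ^ k * PowerSeries.coeff k p

/-- `dp/dt`. -/
noncomputable def ddt (p : A⟦X⟧) : A⟦X⟧ :=
  PowerSeries.mk fun k => (k + 1) • PowerSeries.coeff (k + 1) p

/-- `e^p = q`: for every `k`, the coefficients of `t ^ k` of the partial sums of
`∑ p ^ j / j!` are eventually equal to that of `q`. -/
def IsExp (K : Type*) [CommRing K] [Algebra ℚ K] [Algebra K A] (p q : A⟦X⟧) : Prop :=
  ∀ k : ℕ, ∀ᶠ N in Filter.atTop,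
    PowerSeries.coeff k (∑ j ∈ Finset.range N, algebraMap ℚ K ((j ! : ℚ)⁻¹) • p ^ j) =
      PowerSeries.coeff k q

/-- The 5-tuple `Ω = (f, g, d, h, m)` is an NCS (noncommutative symmetric) system over the
`K`-algebra `A`. -/
structure IsNCSSystem (K : Type*) [CommRing K] [Algebra ℚ K] [Algebra K A]
    (Ω : NCSTuple A) : Prop where
  f_zero : PowerSeries.coeff 0 Ω.f = 1
  f_neg_mul_g : negT Ω.f * Ω.g = 1
  g_mul_f_neg : Ω.g * negT Ω.f = 1
  exp_d : IsExp K Ω.d Ω.g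
  ddt_g_eq_g_mul_h : ddt Ω.g = Ω.g * Ω.h
  ddt_g_eq_m_mul_g : ddt Ω.g = Ω.m * Ω.g

end

end NCSTuple

/-! ### The 5-tuple attached to an automorphism -/

namespace FormalSeries

section

/- Here `A` stands for the power series in `z` over `K`, and `B` for those over `K⟦t⟧`. -/
variable {W : Type} {n : ℕ} {K A B : Type*} [CommRing K]
  [Ring A] [Algebra K A] [FormalSeries W n K A]
  [Ring B] [Algebra K⟦X⟧ B] [FormalSeries W n K⟦X⟧ B]

/-- The coefficient of `t ^ k` of `u = ∑ u_k(z) t ^ k`, a power series in `z` over `K`. -/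
noncomputable def tCoeff (A : Type*) [FormalSeries W n K A] (k : ℕ) (u : B) : A :=
  coeffs.symm fun w => PowerSeries.coeff k (coeffs u w)

/-- The series `∑ a_k(z) t ^ k`. -/
noncomputable def ofTCoeff (a : ℕ → A) : B :=
  coeffs.symm fun w => PowerSeries.mk fun k => coeffs (a k) w

/-- `∂u/∂t`, computed on each coefficient. -/
noncomputable def partialT (u : B) : B :=
  coeffs.symm fun w => PowerSeries.derivative K (coeffs u w)

/-- `u` vanishes at `t = 0`. -/
def VanishesAtZero (u : B) : Prop := ∀ w : W, PowerSeries.coeff 0 (coeffs u w) = 0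

/-- The action of `P = ∑ t ^ k P_k`, a power series in `t` whose coefficients are differential
operators, on power series in `z` over `K⟦t⟧`:
`P (∑ t ^ j u_j) = ∑_k t ^ k ∑_{i + j = k} P_i u_j`. -/
noncomputable def act {α : ℕ} (P : (diffOp K A α)⟦X⟧) (u : B) : B :=
  ofTCoeff fun k => ∑ p ∈ Finset.HasAntidiagonal.antidiagonal k,
    ((PowerSeries.coeff p.1 P : diffOp K A α) : Module.End K A) (tCoeff A p.2 u)

/-- `H_t` in `F_t(z) = z - H_t(z)`. The automorphism `F` is the map `u ↦ u(F_t(z))`; in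
particular `F (var i)` is the `i`-th component of `F_t(z)`. -/
noncomputable def serH (F : B ≃ₐ[K⟦X⟧] B) (i : Fin n) : B := var i - F (var i)

/-- `M_t` in `G_t(z) = z + M_t(z)`, where `G_t` is the inverse of `F_t`. -/
noncomputable def serM (F : B ≃ₐ[K⟦X⟧] B) (i : Fin n) : B := F.symm (var i) - var i

/-- The `K⟦t⟧`-automorphisms of the form `F_t(z) = z - H_t(z)` with `o(H_t) ≥ α` and
`H_{t=0} = 0`. -/
def autGE (B : Type*) [Ring B] [Algebra K⟦X⟧ B] [FormalSeries W n K⟦X⟧ B] (α : ℕ) :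
    Set (B ≃ₐ[K⟦X⟧] B) :=
  {F | ∀ i, OrderGE α (serH F i) ∧ VanishesAtZero (serH F i)}

variable [Algebra ℚ K]

/-- `e^δ u = v`: every coefficient (of a monomial in `z` and a power of `t`) of the partial sums
of `∑ δ ^ j u / j!` is eventually equal to that of `v`. -/
def IsExpApply (δ : Module.End K⟦X⟧ B) (u v : B) : Prop :=
  ∀ (w : W) (k : ℕ), ∀ᶠ N in Filter.atTop,
    PowerSeries.coeff k (coeffs
      (∑ j ∈ Finset.range N, algebraMap ℚ K⟦X⟧ ((j ! : ℚ)⁻¹) • (δ ^ j) u) w) =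
    PowerSeries.coeff k (coeffs v w)

/-- `a` is the D-Log of `F` and `δ = [a ∂/∂z]`: the series `a` satisfies `a_{t=0} = 0`,
`o(a) ≥ α` and `e^{[a ∂/∂z]} z = F_t(z)`. -/
structure IsDLog (α : ℕ) (F : B ≃ₐ[K⟦X⟧] B) (a : Fin n → B) (δ : Module.End K⟦X⟧ B) :
    Prop where
  vanishes : ∀ i, VanishesAtZero (a i)
  order : ∀ i, OrderGE α (a i)
  vectorField : IsVectorField a δ
  exp : ∀ i, IsExpApply δ (var i) (F (var i))

/-- `Ω = (f, g, d, h, m)` is the 5-tuple attached to the automorphism `F = F_t` with inverse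
`G = G_t`. Note that `u(F_t)` is `F u`, and `u(G_t)` is `F.symm u`. -/
structure IsOmega (α : ℕ) (F : B ≃ₐ[K⟦X⟧] B) (Ω : NCSTuple (diffOp K A α)) : Prop where
  /-- `f(-t) u = u(F_t)` for all series `u` -/
  f_spec : ∀ u : B, act (NCSTuple.negT Ω.f) u = F u
  /-- `g(t) u = u(G_t)` for all series `u` -/
  g_spec : ∀ u : B, act Ω.g u = F.symm u
  /-- `d(t) = -[a ∂/∂z]`, with `a` the D-Log of `F` -/
  d_spec : ∃ (a : Fin n → B) (δ : Module.End K⟦X⟧ B), IsDLog α F a δ ∧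
    ∀ u : B, act Ω.d u = -δ u
  /-- the coefficients of `d(t)` are derivations -/
  d_der : ∀ k, ((PowerSeries.coeff k Ω.d : diffOp K A α) : Module.End K A) ∈ derGE K A α
  /-- `h(t) = [(∂M_t/∂t)(F_t) ∂/∂z]` -/
  h_spec : ∃ δ : Module.End K⟦X⟧ B, IsVectorField (fun i => F (partialT (serM F i))) δ ∧
    ∀ u : B, act Ω.h u = δ u
  /-- the coefficients of `h(t)` are derivations -/
  h_der : ∀ k, ((PowerSeries.coeff k Ω.h : diffOp K A α) : Module.End K A) ∈ derGE K A α
  /-- `m(t) = [(∂H_t/∂t)(G_t) ∂/∂z]` -/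
  m_spec : ∃ δ : Module.End K⟦X⟧ B, IsVectorField (fun i => F.symm (partialT (serH F i))) δ ∧
    ∀ u : B, act Ω.m u = δ u
  /-- the coefficients of `m(t)` are derivations -/
  m_der : ∀ k, ((PowerSeries.coeff k Ω.m : diffOp K A α) : Module.End K A) ∈ derGE K A α

end

end FormalSeries

/-! Write `A` and `B` for the series over `K` and over `K⟦X⟧`. Expanding in t identifies `B` with
`A⟦X⟧`, and every `K⟦X⟧`-linear operator on `B` is a unique power series in t with coefficients in
`Module.End K A` (`tExpansion`, `exists_toEnd_eq`, `opHom_injective`). The automorphism F thus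
becomes a multiplicative series P, with constant term 1 because F fixes the variables modulo t. Such
a series has a unique logarithm D without constant term (`exists_expSeries_eq`,
`expSeries_injective`).

The central point is that the coefficients of D are derivations of the right order
(`coeff_mem_derGE_of_expSeries`). Inductively, e^D and the exponential of D truncated below degree k
are multiplicative and agree below degree k. Their difference in degree k is the k-th coefficient of
D, and the first difference of two multiplicative deformations of the identity is a derivation
(`isDerivation_coeff_sub`). Its order is read off from its values on the variables.

The tuple is then forced: f(-t) = e^D, g = e^(-D), d = -D, h = g⁻¹g', m = g'g⁻¹, and the NCS
equations are formal. That h and m are the stated vector fields follows from the product rule in t.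
Uniqueness holds because operator series act faithfully, derivations are determined by the
variables, and so are multiplicative series with constant term 1 (`opHom_ext_var`), which settles
the D-Log. -/

set_option linter.unusedSectionVars false

/-! ### Exponential and logarithm of power series over a noncommutative ring. -/

namespace PowerSeries

section LimSum

variable {R : Type*} [Ring R]

/-- The family `a` is graded: `a j` is divisible by `X ^ j`. -/
def IsGradedFamily (a : ℕ → R⟦X⟧) : Prop := ∀ j k, k < j → coeff k (a j) = 0

/-- The sum of a graded family of power series. -/
noncomputable def limSum (a : ℕ → R⟦X⟧) : R⟦X⟧ :=
  mk fun k => ∑ j ∈ Finset.range (k + 1), coeff k (a j)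

theorem IsGradedFamily.coeff_limSum {a : ℕ → R⟦X⟧} (ha : IsGradedFamily a) {k N : ℕ}
    (hN : k < N) : coeff k (limSum a) = coeff k (∑ j ∈ Finset.range N, a j) := by
  rw [limSum, coeff_mk, map_sum]
  refine Finset.sum_subset (Finset.range_mono hN) fun j _ hj => ha j k ?_
  simp only [Finset.mem_range, not_lt] at hj
  omega

theorem coeff_mul_eq_zero_of_lt {p q : R⟦X⟧} {i j k : ℕ} (hp : ∀ l < i, coeff l p = 0)
    (hq : ∀ l < j, coeff l q = 0) (hk : k < i + j) : coeff k (p * q) = 0 := by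
  rw [coeff_mul]
  refine Finset.sum_eq_zero fun x hx => ?_
  rw [Finset.HasAntidiagonal.mem_antidiagonal] at hx
  rcases lt_or_ge x.1 i with h | h
  · rw [hp _ h, zero_mul]
  · rw [hq _ (by omega), mul_zero]

theorem coeff_mul_congr {p p' q q' : R⟦X⟧} {k : ℕ} (hp : ∀ l ≤ k, coeff l p = coeff l p')
    (hq : ∀ l ≤ k, coeff l q = coeff l q') : coeff k (p * q) = coeff k (p' * q') := by
  rw [coeff_mul, coeff_mul]
  refine Finset.sum_congr rfl fun x hx => ?_
  rw [Finset.HasAntidiagonal.mem_antidiagonal] at hx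
  rw [hp _ (by omega), hq _ (by omega)]

/-- In degree k the left side sums over a square of index pairs and the right side over the triangle
i + j ≤ k. The remaining pairs contribute nothing, since their products are divisible by X ^ (i +
j). -/
theorem limSum_mul_limSum {a b : ℕ → R⟦X⟧} (ha : IsGradedFamily a) (hb : IsGradedFamily b) :
    limSum a * limSum b =
      limSum fun m => ∑ p ∈ Finset.HasAntidiagonal.antidiagonal m, a p.1 * b p.2 := by
  ext k
  have hN : ∀ l ≤ k, l < k + 1 := fun l hl => by omega
  rw [coeff_mul_congr (fun l hl => ha.coeff_limSum (hN l hl))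
    (fun l hl => hb.coeff_limSum (hN l hl)), limSum, coeff_mk, Finset.sum_mul_sum,
    ← Finset.sum_product', map_sum]
  -- The antidiagonals are the fibres of (i, j) ↦ i + j on the triangle.
  have h1 : ∀ m ∈ Finset.range (k + 1), Finset.HasAntidiagonal.antidiagonal m =
      {p ∈ {p ∈ Finset.range (k + 1) ×ˢ Finset.range (k + 1) | p.1 + p.2 < k + 1} |
        p.1 + p.2 = m} := by
    intro m hm
    ext p
    simp only [Finset.mem_range] at hm
    simp only [Finset.HasAntidiagonal.mem_antidiagonal, Finset.mem_filter, Finset.mem_product, Finset.mem_range]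
    omega
  have h2 : ∑ m ∈ Finset.range (k + 1), coeff k (∑ p ∈ Finset.HasAntidiagonal.antidiagonal m, a p.1 * b p.2) =
      ∑ p ∈ Finset.range (k + 1) ×ˢ Finset.range (k + 1) with p.1 + p.2 < k + 1,
        coeff k (a p.1 * b p.2) := by
    rw [← Finset.sum_fiberwise_of_maps_to (t := Finset.range (k + 1)) (g := fun p : ℕ × ℕ => p.1 + p.2)
      fun p hp => by simpa using (Finset.mem_filter.1 hp).2]
    exact Finset.sum_congr rfl fun m hm => by rw [h1 m hm, map_sum]
  rw [h2]
  symm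
  refine Finset.sum_subset (Finset.filter_subset _ _) fun p hp hp' => ?_
  have : ¬ p.1 + p.2 < k + 1 := fun h => hp' (Finset.mem_filter.2 ⟨hp, h⟩)
  exact coeff_mul_eq_zero_of_lt (ha p.1) (hb p.2) (by omega)

end LimSum

section Exp

variable {R : Type*} [Ring R]

theorem coeff_pow_eq_zero {p : R⟦X⟧} (hp : coeff 0 p = 0) (j k : ℕ) (hk : k < j) :
    coeff k (p ^ j) = 0 := by
  induction j generalizing k with
  | zero => omega
  | succ j ih =>
    rw [pow_succ]
    refine coeff_mul_eq_zero_of_lt (j := 1) ih (fun l hl => ?_) hk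
    rwa [Nat.lt_one_iff.1 hl]

theorem coeff_pow_congr {p q : R⟦X⟧} {k : ℕ} (h : ∀ l ≤ k, coeff l p = coeff l q) (j : ℕ) :
    coeff k (p ^ j) = coeff k (q ^ j) := by
  induction j generalizing k with
  | zero => simp
  | succ j ih =>
    rw [pow_succ, pow_succ]
    exact coeff_mul_congr (fun l hl => ih fun i hi => h i (hi.trans hl)) h

theorem coeff_mem_of_pow {S : Type*} [SetLike S R] [AddSubmonoidClass S R] [MulMemClass S R]
    (s : S) {p : R⟦X⟧} (hp : ∀ k, coeff k p ∈ s) (j k : ℕ) : coeff k (p ^ (j + 1)) ∈ s := by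
  induction j generalizing k with
  | zero => simpa using hp k
  | succ j ih =>
    rw [pow_succ, coeff_mul]
    exact sum_mem fun x _ => mul_mem (ih _) (hp _)

theorem coeff_base_smul {K : Type*} [CommRing K] [Algebra K R] (c : K) (p : R⟦X⟧) (k : ℕ) :
    coeff k (c • p) = c • coeff k p := rfl

variable (K : Type*) [CommRing K] [Algebra ℚ K] [Algebra K R]

/-- `1 / j!` in a `ℚ`-algebra. -/
noncomputable def invFactorial (j : ℕ) : K := algebraMap ℚ K ((j ! : ℚ)⁻¹)

theorem invFactorial_zero : invFactorial K 0 = 1 := by simp [invFactorial]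

theorem invFactorial_one : invFactorial K 1 = 1 := by simp [invFactorial]

theorem choose_mul_invFactorial {i j m : ℕ} (h : i + j = m) :
    (m.choose i : K) * invFactorial K m = invFactorial K i * invFactorial K j := by
  subst h
  rw [invFactorial, invFactorial, invFactorial, ← map_natCast (algebraMap ℚ K), ← map_mul,
    ← map_mul]
  congr 1
  have h1 : ((i + j).choose i : ℚ) * i ! * j ! = (i + j)! := by
    rw [Nat.choose_symm_add]
    exact_mod_cast Nat.add_choose_mul_factorial_mul_factorial i j
  have hi : (i ! : ℚ) ≠ 0 := by exact_mod_cast Nat.factorial_ne_zero i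
  have hj : (j ! : ℚ) ≠ 0 := by exact_mod_cast Nat.factorial_ne_zero j
  rw [← h1]
  have hc : ((i + j).choose i : ℚ) ≠ 0 := by
    exact_mod_cast (Nat.choose_pos (Nat.le_add_right i j)).ne'
  field_simp

/-- The exponential of a power series without constant term over a noncommutative algebra. -/
noncomputable def expSeries (p : R⟦X⟧) : R⟦X⟧ := limSum fun j => invFactorial K j • p ^ j

variable {K}

theorem isGradedFamily_smul_pow {p : R⟦X⟧} (hp : coeff 0 p = 0) (c : ℕ → K) :
    IsGradedFamily fun j => c j • p ^ j := fun j k hk => by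
  rw [coeff_base_smul, coeff_pow_eq_zero hp j k hk, smul_zero]

theorem coeff_expSeries (p : R⟦X⟧) (k : ℕ) : coeff k (expSeries K p) =
    ∑ j ∈ Finset.range (k + 1), invFactorial K j • coeff k (p ^ j) := by
  simp only [expSeries, limSum, coeff_mk, coeff_base_smul]

theorem coeff_zero_expSeries (p : R⟦X⟧) : coeff 0 (expSeries K p) = 1 := by
  simp [coeff_expSeries, invFactorial_zero]

theorem isExp_iff {p q : R⟦X⟧} (hp : coeff 0 p = 0) :
    NCSTuple.IsExp K p q ↔ q = expSeries K p := by
  have key : ∀ k N, k < N → coeff k (∑ j ∈ Finset.range N,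
      algebraMap ℚ K ((j ! : ℚ)⁻¹) • p ^ j) = coeff k (expSeries K p) := fun k N hN =>
    ((isGradedFamily_smul_pow hp (invFactorial K)).coeff_limSum hN).symm
  constructor
  · intro h
    ext k
    obtain ⟨N, hN, hk⟩ := ((h k).and (Filter.eventually_gt_atTop k)).exists
    rw [← hN, key k N hk]
  · rintro rfl k
    filter_upwards [Filter.eventually_gt_atTop k] with N hN using key k N hN

theorem expSeries_zero : expSeries K (0 : R⟦X⟧) = 1 := by
  ext k
  rw [coeff_expSeries, Finset.sum_range_succ', pow_zero, invFactorial_zero, one_smul,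
    Finset.sum_eq_zero, zero_add]
  intro j _
  simp

theorem expSeries_add {p q : R⟦X⟧} (hp : coeff 0 p = 0) (hq : coeff 0 q = 0)
    (hpq : Commute p q) : expSeries K (p + q) = expSeries K p * expSeries K q := by
  rw [expSeries, expSeries, expSeries, limSum_mul_limSum (isGradedFamily_smul_pow hp _)
    (isGradedFamily_smul_pow hq _)]
  congr 1
  funext m
  rw [hpq.add_pow', Finset.smul_sum]
  refine Finset.sum_congr rfl fun x hx => ?_
  rw [Finset.HasAntidiagonal.mem_antidiagonal] at hx
  rw [smul_mul_smul_comm, ← choose_mul_invFactorial K hx, ← Nat.cast_smul_eq_nsmul K, smul_smul,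
    mul_comm]

theorem expSeries_mul_expSeries_neg {p : R⟦X⟧} (hp : coeff 0 p = 0) :
    expSeries K p * expSeries K (-p) = 1 := by
  rw [← expSeries_add hp (by rw [map_neg, hp, neg_zero]) (Commute.neg_right rfl), add_neg_cancel, expSeries_zero]

theorem expSeries_neg_mul_expSeries {p : R⟦X⟧} (hp : coeff 0 p = 0) :
    expSeries K (-p) * expSeries K p = 1 := by
  simpa using expSeries_mul_expSeries_neg (K := K) (p := -p) (by rw [map_neg, hp, neg_zero])

/-- The exponential is triangular: without constant terms, a product of at least two factors sees in
degree k only coefficients below k, so only the linear term distinguishes p from q. Existence and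
uniqueness of logarithms both rest on this. -/
theorem coeff_expSeries_sub {p q : R⟦X⟧} (hp : coeff 0 p = 0) (hq : coeff 0 q = 0) {k : ℕ}
    (h : ∀ l < k, coeff l p = coeff l q) :
    coeff k (expSeries K p) - coeff k (expSeries K q) = coeff k p - coeff k q := by
  rcases k with _ | k
  · simp [coeff_zero_expSeries, hp, hq]
  rw [coeff_expSeries, coeff_expSeries, Finset.sum_range_succ', Finset.sum_range_succ',
    Finset.sum_range_succ', Finset.sum_range_succ']
  have : ∀ j, coeff (k + 1) (p ^ (j + 1 + 1)) = coeff (k + 1) (q ^ (j + 1 + 1)) := by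
    intro j
    rw [pow_succ, pow_succ q, coeff_mul, coeff_mul]
    refine Finset.sum_congr rfl fun x hx => ?_
    rw [Finset.HasAntidiagonal.mem_antidiagonal] at hx
    rcases Nat.eq_zero_or_pos x.1 with h1 | h1
    · rw [h1, coeff_pow_eq_zero hp _ _ (by omega), coeff_pow_eq_zero hq _ _ (by omega), zero_mul,
        zero_mul]
    rcases Nat.eq_zero_or_pos x.2 with h2 | h2
    · rw [h2, hp, hq, mul_zero, mul_zero]
    rw [h x.2 (by omega), coeff_pow_congr (fun l hl => h l (by omega))]
  simp only [this, zero_add, pow_one, pow_zero, invFactorial_one, one_smul]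
  abel

theorem expSeries_injective {p q : R⟦X⟧} (hp : coeff 0 p = 0) (hq : coeff 0 q = 0)
    (h : expSeries K p = expSeries K q) : p = q := by
  ext k
  induction k using Nat.strong_induction_on with
  | _ k ih =>
    have := coeff_expSeries_sub (K := K) hp hq ih
    rw [h, sub_self] at this
    exact (sub_eq_zero.1 this.symm)

/-- The terms of degree less than `k`. -/
noncomputable def below (k : ℕ) (p : R⟦X⟧) : R⟦X⟧ := mk fun i => if i < k then coeff i p else 0

theorem coeff_below (k i : ℕ) (p : R⟦X⟧) :
    coeff i (below k p) = if i < k then coeff i p else 0 := coeff_mk _ _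

variable (K) in
/-- The coefficients of the logarithm of a power series with constant term `1`. -/
noncomputable def logCoeff (x : R⟦X⟧) (k : ℕ) : R :=
  coeff k x - coeff k (expSeries K (mk fun i => if _h : i < k then logCoeff x i else 0))
termination_by k

/-- By triangularity, the k-th coefficient of the logarithm is what the exponential of the earlier
part misses in degree k. -/
theorem exists_expSeries_eq {x : R⟦X⟧} (hx : coeff 0 x = 1) :
    ∃ p : R⟦X⟧, coeff 0 p = 0 ∧ expSeries K p = x := by
  have h0 : logCoeff K x 0 = 0 := by rw [logCoeff, hx, coeff_zero_expSeries, sub_self]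
  refine ⟨mk (logCoeff K x), by rw [coeff_mk, h0], ?_⟩
  ext k
  have h := coeff_expSeries_sub (K := K) (p := mk (logCoeff K x))
    (q := mk fun i => if _h : i < k then logCoeff K x i else 0) (k := k)
    (by rw [coeff_mk, h0]) (by rw [coeff_mk, h0]; simp)
    (fun l hl => by rw [coeff_mk, coeff_mk, dif_pos hl])
  rw [coeff_mk, coeff_mk, dif_neg (lt_irrefl k), sub_zero, logCoeff] at h
  exact sub_left_injective h

theorem coeff_expSeries_below (p : R⟦X⟧) {k l : ℕ} (hl : l < k) :
    coeff l (expSeries K (below k p)) = coeff l (expSeries K p) := by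
  rw [coeff_expSeries, coeff_expSeries]
  refine Finset.sum_congr rfl fun j _ => ?_
  rw [coeff_pow_congr (q := p) fun i hi => by rw [coeff_below, if_pos (by omega)]]

/-- This form matches `isDerivation_coeff_sub`: the two exponentials agree in all degrees below k.
-/
theorem coeff_eq_coeff_expSeries_sub {p : R⟦X⟧} (hp : coeff 0 p = 0) (k : ℕ) :
    coeff k p = coeff k (expSeries K p) - coeff k (expSeries K (below k p)) := by
  rw [coeff_expSeries_sub hp (by rw [coeff_below, hp, ite_self])
    fun l hl => by rw [coeff_below, if_pos hl], coeff_below, if_neg (lt_irrefl k), sub_zero]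

/-- Meant for non-unital `s` such as `raising K A s`; in positive degree the term 1 of the
exponential drops out. -/
theorem coeff_expSeries_mem {S : Type*} [SetLike S R] [AddSubmonoidClass S R] [MulMemClass S R]
    [SMulMemClass S K R] (s : S) {p : R⟦X⟧} (hp : ∀ k, coeff k p ∈ s) {k : ℕ} (hk : k ≠ 0) :
    coeff k (expSeries K p) ∈ s := by
  rw [coeff_expSeries, Finset.sum_range_succ', pow_zero, coeff_one, if_neg hk, smul_zero, add_zero]
  exact sum_mem fun j _ => SMulMemClass.smul_mem _ (coeff_mem_of_pow s hp j k)

theorem map_expSeries {R' : Type*} [Ring R'] [Algebra K R'] (e : R →ₐ[K] R') (p : R⟦X⟧) :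
    map (e : R →+* R') (expSeries K p) = expSeries K (map (e : R →+* R') p) := by
  ext k
  simp only [coeff_map, coeff_expSeries, map_sum, ← map_pow, RingHom.coe_coe, map_smul]

end Exp

end PowerSeries

/-! ### Reindexing of triple convolution sums. -/

section Antidiagonal

variable {M : Type*} [AddCommMonoid M]

theorem sum_antidiagonal_assoc (f : ℕ → ℕ → ℕ → M) (k : ℕ) :
    ∑ x ∈ Finset.HasAntidiagonal.antidiagonal k,
      ∑ y ∈ Finset.HasAntidiagonal.antidiagonal x.1, f y.1 y.2 x.2 =
    ∑ x ∈ Finset.HasAntidiagonal.antidiagonal k,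
      ∑ y ∈ Finset.HasAntidiagonal.antidiagonal x.2, f x.1 y.1 y.2 := by
  simp only [Finset.sum_sigma']
  apply Finset.sum_nbij' (fun ⟨⟨_i, j⟩, ⟨k, l⟩⟩ ↦ ⟨(k, l + j), (l, j)⟩)
    (fun ⟨⟨i, _j⟩, ⟨k, l⟩⟩ ↦ ⟨(i + k, l), (i, k)⟩)
  · rintro ⟨⟨i, j⟩, ⟨k, l⟩⟩
    simp only [Finset.mem_sigma, Finset.HasAntidiagonal.mem_antidiagonal, and_imp]
    rintro rfl rfl
    simp [add_assoc]
  · rintro ⟨⟨i, j⟩, ⟨k, l⟩⟩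
    simp only [Finset.mem_sigma, Finset.HasAntidiagonal.mem_antidiagonal, and_imp]
    rintro rfl rfl
    simp [add_assoc]
  · rintro ⟨⟨i, j⟩, ⟨k, l⟩⟩ h
    simp only [Finset.mem_sigma, Finset.HasAntidiagonal.mem_antidiagonal] at h
    simp [h.2]
  · rintro ⟨⟨i, j⟩, ⟨k, l⟩⟩ h
    simp only [Finset.mem_sigma, Finset.HasAntidiagonal.mem_antidiagonal] at h
    simp [h.2]
  · rintro ⟨⟨i, j⟩, ⟨k, l⟩⟩ h
    rfl

theorem sum_antidiagonal_left_comm (f : ℕ → ℕ → ℕ → M) (k : ℕ) :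
    ∑ x ∈ Finset.HasAntidiagonal.antidiagonal k,
      ∑ y ∈ Finset.HasAntidiagonal.antidiagonal x.2, f x.1 y.1 y.2 =
    ∑ x ∈ Finset.HasAntidiagonal.antidiagonal k,
      ∑ y ∈ Finset.HasAntidiagonal.antidiagonal x.2, f y.1 x.1 y.2 := by
  rw [← sum_antidiagonal_assoc, ← sum_antidiagonal_assoc fun i j l => f j i l]
  exact Finset.sum_congr rfl fun x _ => Finset.Nat.sum_antidiagonal_swap.symm

end Antidiagonal

/-! ### Power series of operators, derivations and multiplicative operators. -/

namespace PowerSeries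

open FormalSeries (IsDerivation)

variable {K A : Type*} [CommRing K] [Ring A] [Algebra K A]

/-- A power series of endomorphisms of `A` acts on power series over `A`. -/
noncomputable def opHom : (Module.End K A)⟦X⟧ →+* Module.End K A⟦X⟧ where
  toFun P :=
    { toFun := fun u => mk fun k => ∑ x ∈ Finset.HasAntidiagonal.antidiagonal k,
        coeff x.1 P (coeff x.2 u)
      map_add' := fun u v => by
        ext k
        simp only [coeff_mk, map_add, Finset.sum_add_distrib]
      map_smul' := fun c u => by
        ext k
        simp only [coeff_mk, coeff_base_smul, map_smul, Finset.smul_sum, RingHom.id_apply] }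
  map_one' := by
    ext u k
    simp only [LinearMap.coe_mk, AddHom.coe_mk, coeff_mk, Module.End.one_apply]
    rw [Finset.sum_eq_single (0, k)]
    · simp
    · intro x hx hne
      rw [Finset.HasAntidiagonal.mem_antidiagonal] at hx
      have : x.1 ≠ 0 := fun h => hne (Prod.ext h (by simp_all))
      rw [coeff_one, if_neg this, LinearMap.zero_apply]
    · intro h
      simp at h
  map_mul' P Q := by
    ext u k
    simp only [LinearMap.coe_mk, AddHom.coe_mk, coeff_mk, Module.End.mul_apply, coeff_mul,
      LinearMap.sum_apply, map_sum]
    exact sum_antidiagonal_assoc (fun a b c => coeff a P (coeff b Q (coeff c u))) k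
  map_zero' := by
    ext u k
    simp
  map_add' P Q := by
    ext u k
    simp [Finset.sum_add_distrib]

theorem coeff_opHom (P : (Module.End K A)⟦X⟧) (u : A⟦X⟧) (k : ℕ) :
    coeff k (opHom P u) =
      ∑ x ∈ Finset.HasAntidiagonal.antidiagonal k, coeff x.1 P (coeff x.2 u) :=
  coeff_mk k fun k => ∑ x ∈ Finset.HasAntidiagonal.antidiagonal k, coeff x.1 P (coeff x.2 u)

theorem coeff_opHom_C (P : (Module.End K A)⟦X⟧) (a : A) (k : ℕ) :
    coeff k (opHom P (C a)) = coeff k P a := by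
  rw [coeff_opHom, Finset.sum_eq_single (k, 0)]
  · simp
  · intro x hx hne
    rw [Finset.HasAntidiagonal.mem_antidiagonal] at hx
    have : x.2 ≠ 0 := fun h => hne (Prod.ext (by simp_all) h)
    rw [coeff_C, if_neg this, map_zero]
  · intro h
    simp at h

theorem opHom_injective : Function.Injective (opHom : (Module.End K A)⟦X⟧ →+* _) := by
  intro P Q h
  ext k a
  rw [← coeff_opHom_C, h, coeff_opHom_C]

theorem opHom_map_algebraMap (p : K⟦X⟧) (u : A⟦X⟧) :
    opHom (map (algebraMap K (Module.End K A)) p) u = map (algebraMap K A) p * u := by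
  ext k
  rw [coeff_opHom, coeff_mul]
  simp only [coeff_map, Module.algebraMap_end_apply, Algebra.smul_def]

/-- Scalars are central in `Module.End K A`, so multiplication by p is itself an operator series
commuting with P. -/
theorem opHom_map_mul (P : (Module.End K A)⟦X⟧) (p : K⟦X⟧) (u : A⟦X⟧) :
    opHom P (map (algebraMap K A) p * u) = map (algebraMap K A) p * opHom P u := by
  rw [← opHom_map_algebraMap, ← opHom_map_algebraMap, ← Module.End.mul_apply, ← map_mul,
    ← Module.End.mul_apply, ← map_mul]
  congr 2
  ext1 k
  rw [coeff_mul, coeff_mul, ← Finset.Nat.sum_antidiagonal_swap]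
  refine Finset.sum_congr rfl fun x _ => ?_
  simp only [coeff_map, Prod.fst_swap, Prod.snd_swap, Algebra.commutes]

theorem opHom_X_mul (P : (Module.End K A)⟦X⟧) (u : A⟦X⟧) : opHom P (X * u) = X * opHom P u := by
  simpa using opHom_map_mul P X u

/-- The coefficients of P are read off from e on constants. Splitting u as X times its shift plus a
constant reduces degree k + 1 to degree k, so commuting with X replaces any continuity assumption.
-/
theorem exists_opHom_eq (e : Module.End K A⟦X⟧) (h : ∀ u, e (X * u) = X * e u) :
    ∃ P, opHom P = e := by
  let P : (Module.End K A)⟦X⟧ := mk fun k =>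
    { toFun := fun a => coeff k (e (C a))
      map_add' := fun a b => by simp only [map_add]
      map_smul' := fun c a => by
        have : C (c • a) = c • C a := by
          ext k
          simp only [coeff_C, coeff_base_smul]
          split_ifs <;> simp
        rw [this, map_smul, coeff_base_smul, RingHom.id_apply] }
  refine ⟨P, ?_⟩
  have hC : ∀ k a, coeff k (opHom P (C a)) = coeff k (e (C a)) := fun k a => by
    rw [coeff_opHom_C, coeff_mk]
    rfl
  ext u k
  induction k generalizing u with
  | zero =>
    rw [eq_X_mul_shift_add_const u, map_add, map_add, map_add, map_add, hC, h, opHom_X_mul]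
    simp
  | succ k ih =>
    rw [eq_X_mul_shift_add_const u, map_add, map_add, map_add, map_add, hC, h, opHom_X_mul,
      coeff_succ_X_mul, coeff_succ_X_mul, ih]

theorem IsGradedFamily.opHom_limSum {a : ℕ → (Module.End K A)⟦X⟧} (ha : IsGradedFamily a)
    (u : A⟦X⟧) : opHom (limSum a) u = limSum fun j => opHom (a j) u := by
  ext k
  rw [show coeff k (limSum fun j => opHom (a j) u) =
    ∑ j ∈ Finset.range (k + 1), coeff k (opHom (a j) u) from coeff_mk _ _,
    ← map_sum, ← LinearMap.sum_apply, ← map_sum, coeff_opHom, coeff_opHom]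
  refine Finset.sum_congr rfl fun x hx => ?_
  rw [Finset.HasAntidiagonal.mem_antidiagonal] at hx
  rw [ha.coeff_limSum (N := k + 1) (by omega)]

theorem IsGradedFamily.opHom_apply {a : ℕ → (Module.End K A)⟦X⟧} (ha : IsGradedFamily a)
    (u : A⟦X⟧) : IsGradedFamily fun j => opHom (a j) u := by
  intro j k hk
  rw [coeff_opHom]
  refine Finset.sum_eq_zero fun x hx => ?_
  rw [Finset.HasAntidiagonal.mem_antidiagonal] at hx
  rw [ha j _ (by omega), LinearMap.zero_apply]

theorem opHom_base_smul (c : K) (P : (Module.End K A)⟦X⟧) : opHom (c • P) = c • opHom P := by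
  ext u k
  rw [LinearMap.smul_apply, coeff_base_smul, coeff_opHom, coeff_opHom, Finset.smul_sum]
  rfl

theorem isDerivation_opHom {D : (Module.End K A)⟦X⟧} (h : ∀ k, IsDerivation (coeff k D)) :
    IsDerivation (opHom D) := by
  intro u v
  ext k
  rw [map_add, coeff_opHom, coeff_mul, coeff_mul]
  simp only [coeff_opHom, coeff_mul, map_sum, h _ _ _, Finset.sum_add_distrib, Finset.sum_mul,
    Finset.mul_sum]
  congr 1
  · exact (sum_antidiagonal_assoc
      (fun a b c => coeff a D (coeff b u) * coeff c v) k).symm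
  · exact sum_antidiagonal_left_comm (fun a b c => coeff b u * coeff a D (coeff c v)) k

theorem isDerivation_coeff {D : (Module.End K A)⟦X⟧} (h : IsDerivation (opHom D)) (k : ℕ) :
    IsDerivation (coeff k D) := by
  intro u v
  have := congrArg (coeff k) (h (C u) (C v))
  rwa [← map_mul, map_add, coeff_opHom_C, coeff_mul_C, coeff_C_mul, coeff_opHom_C,
    coeff_opHom_C] at this

/-- The endomorphism `e` is compatible with products. -/
def IsMultiplicative (e : Module.End K A) : Prop := ∀ u v, e (u * v) = e u * e v

theorem isMultiplicative_coeff_zero {P : (Module.End K A)⟦X⟧} (h : IsMultiplicative (opHom P)) :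
    IsMultiplicative (coeff 0 P) := by
  intro u v
  have := congrArg (coeff 0) (h (C u) (C v))
  rwa [← map_mul, coeff_opHom_C, coeff_mul, Finset.Nat.antidiagonal_zero, Finset.sum_singleton,
    coeff_opHom_C, coeff_opHom_C] at this

/-- The first coefficient where two multiplicative operators deforming the identity differ
defines a derivation. -/
theorem isDerivation_coeff_sub {P Q : (Module.End K A)⟦X⟧} (hP : IsMultiplicative (opHom P))
    (hQ : IsMultiplicative (opHom Q)) (hP0 : coeff 0 P = 1) (hQ0 : coeff 0 Q = 1) {k : ℕ}
    (h : ∀ l < k, coeff l P = coeff l Q) : IsDerivation (coeff k P - coeff k Q) := by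
  intro u v
  have h1 := congrArg (coeff k) (hP (C u) (C v))
  have h2 := congrArg (coeff k) (hQ (C u) (C v))
  rw [← map_mul, coeff_opHom_C, coeff_mul] at h1 h2
  simp only [coeff_opHom_C] at h1 h2
  simp only [LinearMap.sub_apply, h1, h2]
  -- Only the two end terms of the convolution involve the k-th coefficients, and these give the
  -- Leibniz rule; the inner terms cancel by `h`. The case k = 1 is separate since it has no inner
  -- terms.
  rcases k with _ | k
  · simp [hP0, hQ0]
  rw [Finset.Nat.sum_antidiagonal_succ, Finset.Nat.sum_antidiagonal_succ]
  rcases k with _ | k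
  · simp only [hP0, hQ0, zero_add, Finset.Nat.antidiagonal_zero, Finset.sum_singleton,
      Module.End.one_apply, sub_mul, mul_sub]
    abel
  rw [Finset.Nat.sum_antidiagonal_succ', Finset.Nat.sum_antidiagonal_succ']
  have : ∀ x ∈ Finset.HasAntidiagonal.antidiagonal k, coeff (x.1 + 1) P u * coeff (x.2 + 1) P v =
      coeff (x.1 + 1) Q u * coeff (x.2 + 1) Q v := fun x hx => by
    rw [Finset.HasAntidiagonal.mem_antidiagonal] at hx
    rw [h _ (by omega), h _ (by omega)]
  rw [Finset.sum_congr rfl this]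
  simp only [hP0, hQ0, Module.End.one_apply, sub_mul, mul_sub]
  abel

theorem _root_.FormalSeries.IsDerivation.pow_apply_mul {δ : Module.End K A} (h : IsDerivation δ)
    (m : ℕ) (u v : A) : (δ ^ m) (u * v) = ∑ x ∈ Finset.HasAntidiagonal.antidiagonal m,
      m.choose x.1 • ((δ ^ x.1) u * (δ ^ x.2) v) := by
  induction m with
  | zero => simp
  | succ m ih =>
    rw [Finset.sum_antidiagonal_choose_succ_nsmul (fun i j => (δ ^ i) u * (δ ^ j) v) m, pow_succ',
      Module.End.mul_apply, ih, map_sum, ← Finset.sum_add_distrib]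
    refine Finset.sum_congr rfl fun x hx => ?_
    rw [Finset.HasAntidiagonal.mem_antidiagonal] at hx
    rw [map_nsmul, h, pow_succ', pow_succ', Module.End.mul_apply, Module.End.mul_apply, smul_add,
      Nat.choose_symm_of_eq_add hx.symm, add_comm]

/-- The iterated Leibniz rule divided by m! is the degree-m part of the Cauchy product of the two
exponential sums. -/
theorem isMultiplicative_expSeries [Algebra ℚ K] {D : (Module.End K A)⟦X⟧} (hD0 : coeff 0 D = 0)
    (hD : IsDerivation (opHom D)) : IsMultiplicative (opHom (expSeries K D)) := by
  intro u v
  have hg := isGradedFamily_smul_pow hD0 (invFactorial K)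
  rw [expSeries, hg.opHom_limSum, hg.opHom_limSum, hg.opHom_limSum,
    limSum_mul_limSum (hg.opHom_apply u) (hg.opHom_apply v)]
  congr 1
  funext m
  rw [opHom_base_smul, map_pow, LinearMap.smul_apply, hD.pow_apply_mul, Finset.smul_sum]
  refine Finset.sum_congr rfl fun x hx => ?_
  rw [Finset.HasAntidiagonal.mem_antidiagonal] at hx
  rw [opHom_base_smul, opHom_base_smul, LinearMap.smul_apply, LinearMap.smul_apply, map_pow,
    map_pow, smul_mul_smul_comm, ← choose_mul_invFactorial K hx, ← Nat.cast_smul_eq_nsmul K,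
    smul_smul, mul_comm]

end PowerSeries

/-! ### The order filtration and determination of operators by the variables. -/

namespace FormalSeries

/-- Compatibility of the coefficients and the variables of a type of formal power series with its
algebra structure. -/
class LawfulSeries {W : outParam Type} {n : outParam ℕ} {R : outParam Type*} (A : Type*)
    [CommRing R] [Ring A] [Algebra R A] [FormalSeries W n R A] : Prop where
  coeffs_add : ∀ (u v : A) (w : W), coeffs (u + v) w = coeffs u w + coeffs v w
  coeffs_smul : ∀ (c : R) (u : A) (w : W), coeffs (c • u) w = c * coeffs u w
  orderGE_mul : ∀ {k l : ℕ} {u v : A}, OrderGE k u → OrderGE l v → OrderGE (k + l) (u * v)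
  orderGE_var : ∀ i, OrderGE 1 (var i : A)
  -- Stripping one variable on the left allows induction on the order, so derivations and
  -- multiplicative maps need no continuity hypothesis.
  exists_eq_add_sum : ∀ u : A, ∃ (c : R) (v : Fin n → A), u = c • 1 + ∑ i, var i * v i ∧
    ∀ k, OrderGE (k + 1) u → ∀ i, OrderGE k (v i)

section

variable {W : Type} {n : ℕ} {K A : Type*} [CommRing K] [Ring A] [Algebra K A]
  [FormalSeries W n K A] [LawfulSeries A]

open LawfulSeries

variable (K A) in
/-- A series as the family of its coefficients, linearly. -/
def coeffsL : A ≃ₗ[K] (W → K) where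
  toFun u := coeffs u
  map_add' u v := funext fun w => coeffs_add u v w
  map_smul' c u := funext fun w => coeffs_smul c u w
  invFun := coeffs.symm
  left_inv u := coeffs.symm_apply_apply u
  right_inv u := coeffs.apply_symm_apply u

variable (K A) in
/-- The series of order at least `k`. -/
def orderSubmodule (k : ℕ) : Submodule K A where
  carrier := {u | OrderGE k u}
  zero_mem' w _ := congrFun (map_zero (coeffsL K A)) w
  add_mem' {u v} hu hv w hw := by rw [coeffs_add, hu w hw, hv w hw, add_zero]
  smul_mem' c u hu w hw := by rw [coeffs_smul, hu w hw, mul_zero]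

theorem OrderGE.mono {k l : ℕ} {u : A} (h : OrderGE k u) (hl : l ≤ k) : OrderGE l u :=
  fun w hw => h w (hw.trans_le hl)

theorem orderGE_zero (u : A) : OrderGE 0 u := fun _ hw => absurd hw (Nat.not_lt_zero _)

theorem eq_zero_of_forall_orderGE {u : A} (h : ∀ k, OrderGE k u) : u = 0 := by
  apply (coeffsL K A).injective
  rw [map_zero]
  exact funext fun w => h _ w (Nat.lt_succ_self _)

variable (K A) in
/-- The linear endomorphisms that increase the order by at least `s`. -/
def raising (s : ℕ) : NonUnitalSubalgebra K (Module.End K A) where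
  carrier := {P | ∀ (k : ℕ) (u : A), OrderGE k u → OrderGE (k + s) (P u)}
  zero_mem' _ _ _ := (orderSubmodule K A _).zero_mem
  add_mem' hP hQ _ _ hu := (orderSubmodule K A _).add_mem (hP _ _ hu) (hQ _ _ hu)
  smul_mem' c _ hP k u hu := (orderSubmodule K A _).smul_mem c (hP k u hu)
  mul_mem' hP hQ _ _ hu := (hP _ _ (hQ _ _ hu)).mono (Nat.le_add_right _ _)

theorem mem_raising {s : ℕ} {P : Module.End K A} :
    P ∈ raising K A s ↔ ∀ (k : ℕ) (u : A), OrderGE k u → OrderGE (k + s) (P u) := Iff.rfl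

theorem raising_le_raising_zero (s : ℕ) : raising K A s ≤ raising K A 0 :=
  fun _ hP k u hu => (hP k u hu).mono (Nat.le_add_right _ _)

theorem one_mem_raising_zero : (1 : Module.End K A) ∈ raising K A 0 := fun _ _ hu => hu

theorem IsDerivation.map_one {δ : Module.End K A} (h : IsDerivation δ) : δ 1 = 0 := by
  have := h 1 1
  simpa using this

/-- The cap m is the precision reached so far. In δ(z_i v_i) = δ(z_i) v_i + z_i δ(v_i) the first
term has the full order, and in the second the factor z_i raises the precision by one. -/
theorem IsDerivation.orderGE_of_var {δ : Module.End K A} (h : IsDerivation δ) {s : ℕ}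
    (hv : ∀ i, OrderGE (s + 1) (δ (var i))) (m : ℕ) :
    ∀ (k : ℕ) (u : A), OrderGE k u → OrderGE (min m (k + s)) (δ u) := by
  induction m with
  | zero => exact fun k u _ => (orderGE_zero _).mono (by omega)
  | succ m ih =>
    intro k u hu
    obtain ⟨c, v, rfl, hvo⟩ := exists_eq_add_sum u
    rw [map_add, map_smul, h.map_one, smul_zero, zero_add, map_sum]
    refine (orderSubmodule K A _).sum_mem fun i _ => ?_
    -- Truncated subtraction is harmless: for k = 0 nothing is claimed about v i.
    have hvi : OrderGE (k - 1) (v i) := by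
      rcases k with _ | k
      · exact orderGE_zero _
      · exact hvo k hu i
    rw [h]
    refine (orderSubmodule K A _).add_mem ?_ ?_
    · exact (orderGE_mul (hv i) hvi).mono (by omega)
    · exact (orderGE_mul (orderGE_var i) (ih _ _ hvi)).mono (by omega)

theorem IsDerivation.mem_raising_of_var {δ : Module.End K A} (h : IsDerivation δ) {s : ℕ}
    (hv : ∀ i, OrderGE (s + 1) (δ (var i))) : δ ∈ raising K A s :=
  fun k u hu => (h.orderGE_of_var hv (k + s) k u hu).mono (by simp)

theorem IsDerivation.eq_zero_of_var {δ : Module.End K A} (h : IsDerivation δ)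
    (hv : ∀ i, δ (var i) = 0) : δ = 0 := by
  ext u
  refine eq_zero_of_forall_orderGE fun k => ?_
  exact (h.mem_raising_of_var (s := k) (fun i => by
    rw [hv i]; exact (orderSubmodule K A _).zero_mem) 0 u (orderGE_zero u)).mono (by omega)

theorem IsDerivation.sub {δ δ' : Module.End K A} (h : IsDerivation δ) (h' : IsDerivation δ') :
    IsDerivation (δ - δ') := by
  intro u v
  simp only [LinearMap.sub_apply, h u v, h' u v, sub_mul, mul_sub]
  abel

theorem IsDerivation.ext_var {δ δ' : Module.End K A} (h : IsDerivation δ) (h' : IsDerivation δ')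
    (hv : ∀ i, δ (var i) = δ' (var i)) : δ = δ' :=
  sub_eq_zero.1 ((h.sub h').eq_zero_of_var fun i => by rw [LinearMap.sub_apply, hv, sub_self])

/-- Since P u - u = ∑ z_i (P v_i - v_i), each round of stripping variables gains one order. -/
theorem eq_one_of_var {P : Module.End K A} (h : PowerSeries.IsMultiplicative P) (h1 : P 1 = 1)
    (hv : ∀ i, P (var i) = var i) : P = 1 := by
  have key : ∀ (k : ℕ) (u : A), OrderGE k (P u - u) := by
    intro k
    induction k with
    | zero => exact fun u => orderGE_zero _
    | succ k ih =>
      intro u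
      obtain ⟨c, v, rfl, -⟩ := exists_eq_add_sum u
      have : P (c • 1 + ∑ i, var i * v i) - (c • 1 + ∑ i, var i * v i) =
          ∑ i, var i * (P (v i) - v i) := by
        simp only [map_add, map_smul, h1, map_sum, h _ _, hv, mul_sub, Finset.sum_sub_distrib]
        abel
      rw [this]
      refine (orderSubmodule K A _).sum_mem fun i _ => ?_
      exact (orderGE_mul (orderGE_var i) (ih (v i))).mono (by omega)
  ext u
  exact sub_eq_zero.1 (eq_zero_of_forall_orderGE fun k => key k u)

open PowerSeries

/-- The first coefficient in which P and Q could differ yields a derivation killing all variables.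
-/
theorem opHom_ext_var {P Q : (Module.End K A)⟦X⟧} (hP : IsMultiplicative (opHom P))
    (hQ : IsMultiplicative (opHom Q)) (hP0 : coeff 0 P = 1) (hQ0 : coeff 0 Q = 1)
    (hv : ∀ k i, coeff k P (var i) = coeff k Q (var i)) : P = Q := by
  ext1 k
  induction k using Nat.strong_induction_on with
  | _ k ih =>
    refine sub_eq_zero.1 ((isDerivation_coeff_sub hP hQ hP0 hQ0 ih).eq_zero_of_var fun i => ?_)
    rw [LinearMap.sub_apply, hv, sub_self]

variable [Algebra ℚ K]

theorem coeff_mem_derGE_of_expSeries {s : ℕ} {D : (Module.End K A)⟦X⟧} (hD0 : coeff 0 D = 0)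
    (hP : IsMultiplicative (opHom (expSeries K D)))
    (hv : ∀ k ≠ 0, ∀ i, OrderGE (s + 1) (coeff k (expSeries K D) (var i))) (k : ℕ) :
    IsDerivation (coeff k D) ∧ coeff k D ∈ raising K A s := by
  induction k using Nat.strong_induction_on with
  | _ k ih =>
    have hb0 : coeff 0 (below k D) = 0 := by rw [coeff_below, hD0, ite_self]
    have hb : ∀ l, IsDerivation (coeff l (below k D)) ∧ coeff l (below k D) ∈ raising K A s := by
      intro l
      rw [coeff_below]
      split_ifs with hl
      · exact ih l hl
      · exact ⟨fun u v => by simp, (raising K A s).zero_mem⟩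
    have hder : IsDerivation (coeff k D) := by
      rw [coeff_eq_coeff_expSeries_sub (K := K) hD0]
      exact isDerivation_coeff_sub hP
        (isMultiplicative_expSeries hb0 (isDerivation_opHom fun l => (hb l).1))
        (coeff_zero_expSeries _) (coeff_zero_expSeries _)
        fun l hl => (coeff_expSeries_below D hl).symm
    refine ⟨hder, hder.mem_raising_of_var fun i => ?_⟩
    rcases eq_or_ne k 0 with rfl | hk
    · rw [hD0]
      exact (orderSubmodule K A _).zero_mem
    · rw [coeff_eq_coeff_expSeries_sub (K := K) hD0]
      -- The truncated exponential raises order by s in positive degrees, and a variable has order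
      -- 1, which gives s + 1.
      refine (orderSubmodule K A _).sub_mem (hv k hk i) ?_
      have := coeff_expSeries_mem (K := K) (raising K A s) (fun l => (hb l).2) hk
      exact (this _ _ (orderGE_var i)).mono (by omega)

end

end FormalSeries

/-! ### Differentiation in t and logarithmic derivatives. -/

namespace NCSTuple

open PowerSeries

/-- The weight k + 1 = i + j is distributed over the two indices, and the terms of weight 0
disappear. Both product rules `ddt_mul` and `ddt_opHom` come from this. -/
theorem sum_antidiagonal_succ_nsmul {M : Type*} [AddCommMonoid M] (f : ℕ → ℕ → M) (k : ℕ) :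
    (k + 1) • ∑ x ∈ Finset.HasAntidiagonal.antidiagonal (k + 1), f x.1 x.2 =
      ∑ x ∈ Finset.HasAntidiagonal.antidiagonal k, (x.1 + 1) • f (x.1 + 1) x.2 +
      ∑ x ∈ Finset.HasAntidiagonal.antidiagonal k, (x.2 + 1) • f x.1 (x.2 + 1) := by
  have h1 := Finset.Nat.sum_antidiagonal_succ (n := k) (f := fun x => x.1 • f x.1 x.2)
  have h2 := Finset.Nat.sum_antidiagonal_succ' (n := k) (f := fun x => x.2 • f x.1 x.2)
  simp only [zero_smul, zero_add] at h1 h2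
  rw [← h1, ← h2, ← Finset.sum_add_distrib, Finset.smul_sum]
  refine Finset.sum_congr rfl fun x hx => ?_
  rw [Finset.HasAntidiagonal.mem_antidiagonal] at hx
  rw [← add_smul, hx]

section

variable {R : Type*} [Ring R]

theorem coeff_ddt (p : R⟦X⟧) (k : ℕ) : coeff k (ddt p) = (k + 1) • coeff (k + 1) p :=
  coeff_mk _ _

theorem ddt_sub (p q : R⟦X⟧) : ddt (p - q) = ddt p - ddt q := by
  ext k
  simp only [map_sub, coeff_ddt, smul_sub]

theorem ddt_C (a : R) : ddt (C a) = 0 := by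
  ext k
  simp [coeff_ddt]

theorem ddt_mul (p q : R⟦X⟧) : ddt (p * q) = ddt p * q + p * ddt q := by
  ext k
  rw [coeff_ddt, coeff_mul, sum_antidiagonal_succ_nsmul fun i j => coeff i p * coeff j q, map_add,
    coeff_mul, coeff_mul]
  simp only [coeff_ddt, smul_mul_assoc, mul_smul_comm]

theorem map_ddt {S : Type*} [Ring S] (f : R →+* S) (p : R⟦X⟧) : map f (ddt p) = ddt (map f p) := by
  ext k
  simp only [coeff_map, coeff_ddt, map_nsmul]

theorem coeff_negT (p : R⟦X⟧) (k : ℕ) : coeff k (negT p) = (-1) ^ k * coeff k p := coeff_mk _ _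

theorem negT_negT (p : R⟦X⟧) : negT (negT p) = p := by
  ext k
  rw [coeff_negT, coeff_negT, ← mul_assoc, ← pow_add, Even.neg_one_pow ⟨k, rfl⟩, one_mul]

end

section

variable {K A : Type*} [CommRing K] [Ring A] [Algebra K A]

theorem ddt_opHom (P : (Module.End K A)⟦X⟧) (u : A⟦X⟧) :
    ddt (opHom P u) = opHom (ddt P) u + opHom P (ddt u) := by
  ext k
  rw [coeff_ddt, coeff_opHom, sum_antidiagonal_succ_nsmul fun i j => coeff i P (coeff j u),
    map_add, coeff_opHom, coeff_opHom]
  simp only [coeff_ddt, map_nsmul, LinearMap.smul_apply]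

/-- As an operator, G' is the commutator of d/dt with G, where d/dt is a derivation and G is
multiplicative. -/
theorem opHom_ddt_mul {G : (Module.End K A)⟦X⟧} (hG : IsMultiplicative (opHom G)) (u v : A⟦X⟧) :
    opHom (ddt G) (u * v) = opHom (ddt G) u * opHom G v + opHom G u * opHom (ddt G) v := by
  have h : ∀ w, opHom (ddt G) w = ddt (opHom G w) - opHom G (ddt w) := fun w => by
    rw [ddt_opHom, add_sub_cancel_right]
  rw [h, h, h, hG, ddt_mul, ddt_mul, map_add, hG, hG, sub_mul, mul_sub]
  abel

/-- Applying F to G'(uv) = G'u · Gv + Gu · G'v turns the undifferentiated factors Gu, Gv back into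
u, v. -/
theorem isDerivation_opHom_mul_ddt {F G : (Module.End K A)⟦X⟧} (hF : IsMultiplicative (opHom F))
    (hG : IsMultiplicative (opHom G)) (hFG : F * G = 1) :
    FormalSeries.IsDerivation (opHom (F * ddt G)) := by
  have h : ∀ u, opHom F (opHom G u) = u := fun u => by
    rw [← Module.End.mul_apply, ← map_mul, hFG, map_one, Module.End.one_apply]
  intro u v
  rw [map_mul opHom, Module.End.mul_apply, opHom_ddt_mul hG, map_add, hF, hF, h, h]
  rfl

theorem isDerivation_opHom_ddt_mul {F G : (Module.End K A)⟦X⟧} (hF : IsMultiplicative (opHom F))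
    (hG : IsMultiplicative (opHom G)) (hGF : G * F = 1) :
    FormalSeries.IsDerivation (opHom (ddt G * F)) := by
  have h : ∀ u, opHom G (opHom F u) = u := fun u => by
    rw [← Module.End.mul_apply, ← map_mul, hGF, map_one, Module.End.one_apply]
  intro u v
  rw [map_mul opHom, Module.End.mul_apply, hF, opHom_ddt_mul hG, h, h]
  rfl

end

end NCSTuple

/-! ### Order estimates for exponentials and their t-derivatives. -/

namespace FormalSeries

open PowerSeries

section

variable {W : Type} {n : ℕ} {K A : Type*} [CommRing K] [Ring A] [Algebra K A]
  [FormalSeries W n K A] [LawfulSeries A] [Algebra ℚ K]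

theorem coeff_mul_mem_raising {s r : ℕ} {P Q : (Module.End K A)⟦X⟧}
    (hP : ∀ k, coeff k P ∈ raising K A s) (hQ : ∀ k, coeff k Q ∈ raising K A r) (t : ℕ)
    (ht : t ≤ r + s) (k : ℕ) : coeff k (P * Q) ∈ raising K A t := by
  rw [coeff_mul]
  refine sum_mem fun x _ l u hu => ?_
  exact (hP _ _ _ (hQ _ _ _ hu)).mono (by omega)

theorem coeff_expSeries_mem_raising_zero {s : ℕ} {P : (Module.End K A)⟦X⟧}
    (hP : ∀ k, coeff k P ∈ raising K A s) (k : ℕ) :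
    coeff k (expSeries K P) ∈ raising K A 0 := by
  rcases eq_or_ne k 0 with rfl | hk
  · rw [coeff_zero_expSeries]
    exact one_mem_raising_zero
  · exact raising_le_raising_zero s (coeff_expSeries_mem _ hP hk)

/-- Differentiation removes the constant term 1, the only coefficient that need not raise the order
by s. -/
theorem coeff_ddt_expSeries_mem_raising {s : ℕ} {P : (Module.End K A)⟦X⟧}
    (hP : ∀ k, coeff k P ∈ raising K A s) (k : ℕ) :
    coeff k (NCSTuple.ddt (expSeries K P)) ∈ raising K A s := by
  rw [NCSTuple.coeff_ddt]
  exact nsmul_mem (coeff_expSeries_mem (K := K) (raising K A s) hP k.succ_ne_zero) _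

end

end FormalSeries

/-! ### Expansion in t: from series over `K⟦X⟧` to t-series over `A`. -/

namespace FormalSeries

/-- `B` is the type of formal power series over `K⟦t⟧` matching the formal power series `A`
over `K`. -/
class LawfulPair {W : outParam Type} {n : outParam ℕ} {K : outParam Type*} (A B : Type*)
    [CommRing K] [Ring A] [Algebra K A] [FormalSeries W n K A]
    [Ring B] [Algebra K⟦X⟧ B] [FormalSeries W n K⟦X⟧ B] : Prop extends LawfulSeries A where
  deg_eq : ∀ w : W, deg B w = deg A w
  coeffs_add' : ∀ (u v : B) (w : W), coeffs (u + v) w = coeffs u w + coeffs v w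
  coeffs_smul' : ∀ (c : K⟦X⟧) (u : B) (w : W), coeffs (c • u) w = c * coeffs u w
  tCoeff_mul : ∀ (k : ℕ) (u v : B), tCoeff A k (u * v) =
    ∑ x ∈ Finset.HasAntidiagonal.antidiagonal k, tCoeff A x.1 u * tCoeff A x.2 v
  tCoeff_var : ∀ (k : ℕ) (i : Fin n), tCoeff A k (var i : B) = if k = 0 then var i else 0

open PowerSeries

section Subalgebra

variable {K R : Type*} [CommRing K] [Ring R] [Algebra K R] {S : Subalgebra K R}

/-- A power series over a subalgebra as a power series over the ambient algebra. -/
noncomputable def endSeries : S⟦X⟧ →+* R⟦X⟧ := map (S.val : S →+* R)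

theorem coeff_endSeries (P : S⟦X⟧) (k : ℕ) : coeff k (endSeries P) = ((coeff k P : S) : R) :=
  coeff_map _ _ _

theorem endSeries_injective : Function.Injective (endSeries : S⟦X⟧ →+* R⟦X⟧) := by
  intro P Q h
  ext1 k
  apply Subtype.ext
  rw [← coeff_endSeries, h, coeff_endSeries]

theorem endSeries_ddt (P : S⟦X⟧) : endSeries (NCSTuple.ddt P) = NCSTuple.ddt (endSeries P) :=
  NCSTuple.map_ddt _ P

theorem endSeries_expSeries [Algebra ℚ K] (P : S⟦X⟧) :
    endSeries (expSeries K P) = expSeries K (endSeries P) :=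
  map_expSeries S.val P

end Subalgebra

section

variable {W : Type} {n : ℕ} {K A B : Type*} [CommRing K]
  [Ring A] [Algebra K A] [FormalSeries W n K A]
  [Ring B] [Algebra K⟦X⟧ B] [FormalSeries W n K⟦X⟧ B] [LawfulPair A B]

open LawfulPair

theorem coeffs_tCoeff (k : ℕ) (u : B) (w : W) :
    coeffs (tCoeff A k u) w = coeff k (coeffs u w) := by
  rw [tCoeff, Equiv.apply_symm_apply]

theorem tCoeff_ofTCoeff (a : ℕ → A) (k : ℕ) : tCoeff A k (ofTCoeff a : B) = a k := by
  apply coeffs.injective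
  funext w
  rw [coeffs_tCoeff, ofTCoeff, Equiv.apply_symm_apply, coeff_mk]

theorem tCoeff_ext {u v : B} (h : ∀ k, tCoeff A k u = tCoeff A k v) : u = v := by
  apply coeffs.injective
  funext w
  ext k
  rw [← coeffs_tCoeff (A := A), h, coeffs_tCoeff]

theorem tCoeff_add (k : ℕ) (u v : B) : tCoeff A k (u + v) = tCoeff A k u + tCoeff A k v := by
  apply coeffs.injective
  funext w
  rw [LawfulSeries.coeffs_add, coeffs_tCoeff, coeffs_tCoeff, coeffs_tCoeff, coeffs_add' A,
    map_add]

theorem tCoeff_smul (k : ℕ) (p : K⟦X⟧) (u : B) : tCoeff A k (p • u) =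
    ∑ x ∈ Finset.HasAntidiagonal.antidiagonal k, coeff x.1 p • tCoeff A x.2 u := by
  apply (coeffsL K A).injective
  rw [map_sum]
  funext w
  rw [Finset.sum_apply]
  simp only [map_smul, Pi.smul_apply]
  change coeffs (tCoeff A k (p • u)) w =
    ∑ x ∈ Finset.HasAntidiagonal.antidiagonal k, coeff x.1 p • coeffs (tCoeff A x.2 u) w
  simp only [coeffs_tCoeff, coeffs_smul' A, coeff_mul, smul_eq_mul]

variable (A B) in
/-- Power series in `z` over `K⟦t⟧` are power series in `t` over the power series in `z`. -/
noncomputable def tExpansion : B ≃+* A⟦X⟧ where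
  toFun u := PowerSeries.mk fun k => tCoeff A k u
  invFun p := ofTCoeff fun k => coeff k p
  left_inv u := tCoeff_ext (A := A) fun k => by rw [tCoeff_ofTCoeff, coeff_mk]
  right_inv p := PowerSeries.ext fun k => by rw [coeff_mk, tCoeff_ofTCoeff]
  map_mul' u v := by
    ext k
    simp only [coeff_mk, coeff_mul, tCoeff_mul]
  map_add' u v := by
    ext k
    simp only [coeff_mk, map_add, tCoeff_add]

theorem coeff_tExpansion (u : B) (k : ℕ) : coeff k (tExpansion A B u) = tCoeff A k u :=
  coeff_mk k fun k => tCoeff A k u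

theorem tExpansion_var (i : Fin n) : tExpansion A B (var i) = C (var i) := by
  ext k
  rw [coeff_tExpansion, tCoeff_var, coeff_C]

theorem tExpansion_smul (p : K⟦X⟧) (u : B) :
    tExpansion A B (p • u) = map (algebraMap K A) p * tExpansion A B u := by
  ext k
  rw [coeff_tExpansion, tCoeff_smul, coeff_mul]
  simp only [coeff_map, coeff_tExpansion, Algebra.smul_def]

theorem tExpansion_act {α : ℕ} (P : (diffOp K A α)⟦X⟧) (u : B) : tExpansion A B (act P u) =
    opHom (endSeries P) (tExpansion A B u) := by
  ext k
  rw [coeff_tExpansion, act, tCoeff_ofTCoeff, coeff_opHom]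
  simp only [coeff_endSeries, coeff_tExpansion]

theorem tExpansion_partialT (u : B) :
    tExpansion A B (partialT u) = NCSTuple.ddt (tExpansion A B u) := by
  ext k
  rw [coeff_tExpansion, NCSTuple.coeff_ddt, coeff_tExpansion]
  apply (coeffsL K A).injective
  rw [map_nsmul]
  funext w
  change coeffs (tCoeff A k (partialT u)) w = (k + 1) • coeffs (tCoeff A (k + 1) u) w
  rw [coeffs_tCoeff, coeffs_tCoeff, partialT, Equiv.apply_symm_apply, PowerSeries.coeff_derivative,
    nsmul_eq_mul, mul_comm]
  push_cast
  rfl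

theorem orderGE_iff_tCoeff {m : ℕ} {u : B} :
    OrderGE m u ↔ ∀ k, OrderGE m (tCoeff A k u) := by
  constructor
  · intro h k w hw
    rw [coeffs_tCoeff, h w (by rwa [deg_eq (A := A) w]), map_zero]
  · intro h w hw
    ext k
    rw [← coeffs_tCoeff (A := A), h k w (by rwa [← deg_eq (B := B) w]), map_zero]

theorem vanishesAtZero_iff_tCoeff {u : B} : VanishesAtZero u ↔ tCoeff A 0 u = 0 := by
  have h0 : ∀ w, coeffs (0 : A) w = 0 := fun w => congrFun (map_zero (coeffsL K A)) w
  constructor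
  · intro h
    apply coeffs.injective
    funext w
    rw [coeffs_tCoeff, h w, h0]
  · intro h w
    rw [← coeffs_tCoeff (A := A), h, h0]

variable (B) in
/-- The `K⟦t⟧`-linear operator given by a power series of operators. -/
noncomputable def toEnd (P : (Module.End K A)⟦X⟧) : Module.End K⟦X⟧ B where
  toFun u := (tExpansion A B).symm (opHom P (tExpansion A B u))
  map_add' u v := by simp only [map_add]
  map_smul' p u := by
    apply (tExpansion A B).injective
    rw [RingEquiv.apply_symm_apply, RingHom.id_apply, tExpansion_smul, tExpansion_smul,
      RingEquiv.apply_symm_apply, opHom_map_mul]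

theorem tExpansion_toEnd (P : (Module.End K A)⟦X⟧) (u : B) :
    tExpansion A B (toEnd B P u) = opHom P (tExpansion A B u) :=
  (tExpansion A B).apply_symm_apply _

-- Transported to `A⟦X⟧`, a `K⟦X⟧`-linear operator commutes with X, which is all that
-- `exists_opHom_eq` asks for.
variable (A) in
theorem exists_toEnd_eq (δ : Module.End K⟦X⟧ B) : ∃ P : (Module.End K A)⟦X⟧, toEnd B P = δ := by
  have hC : ∀ (c : K) (u : A⟦X⟧), c • u = map (algebraMap K A) (C c) * u := fun c u => by
    ext k
    rw [map_C, coeff_C_mul, coeff_base_smul, Algebra.smul_def]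
  have hs : ∀ (p : K⟦X⟧) (u : A⟦X⟧), (tExpansion A B).symm (map (algebraMap K A) p * u) =
      p • (tExpansion A B).symm u := fun p u => by
    apply (tExpansion A B).injective
    rw [tExpansion_smul, RingEquiv.apply_symm_apply, RingEquiv.apply_symm_apply]
  let e : Module.End K A⟦X⟧ :=
    { toFun := fun u => tExpansion A B (δ ((tExpansion A B).symm u))
      map_add' := fun u v => by simp only [map_add]
      map_smul' := fun c u => by
        rw [hC, hs, map_smul, tExpansion_smul, RingHom.id_apply, hC] }
  obtain ⟨P, hP⟩ := exists_opHom_eq e fun u => by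
    have hX := hs X u
    rw [map_X] at hX
    change tExpansion A B (δ ((tExpansion A B).symm (X * u))) = X * tExpansion A B _
    rw [hX, map_smul, tExpansion_smul, map_X]
  refine ⟨P, LinearMap.ext fun u => (tExpansion A B).injective ?_⟩
  rw [tExpansion_toEnd, hP]
  exact congrArg (fun x => tExpansion A B (δ x)) ((tExpansion A B).symm_apply_apply u)

theorem tExpansion_toEnd_pow (P : (Module.End K A)⟦X⟧) (j : ℕ) (u : B) :
    tExpansion A B ((toEnd B P ^ j) u) = opHom (P ^ j) (tExpansion A B u) := by
  induction j with
  | zero => simp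
  | succ j ih =>
    rw [pow_succ', Module.End.mul_apply, tExpansion_toEnd, ih, pow_succ', map_mul opHom,
      Module.End.mul_apply]

theorem isDerivation_toEnd_iff (P : (Module.End K A)⟦X⟧) :
    IsDerivation (toEnd B P) ↔ IsDerivation (opHom P) := by
  constructor
  · intro h u v
    have := congrArg (tExpansion A B)
      (h ((tExpansion A B).symm u) ((tExpansion A B).symm v))
    simpa only [map_mul (tExpansion A B), map_mul (tExpansion A B).symm, map_add,
      tExpansion_toEnd, RingEquiv.apply_symm_apply] using this
  · intro h u v
    apply (tExpansion A B).injective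
    simp only [map_mul (tExpansion A B), map_add, tExpansion_toEnd, h _ _]

theorem coeff_apply_var (P : (Module.End K A)⟦X⟧) (k : ℕ) (i : Fin n) :
    coeff k P (var i) = tCoeff A k (toEnd B P (var i)) := by
  rw [← coeff_tExpansion, tExpansion_toEnd, tExpansion_var, coeff_opHom_C]

theorem IsVectorField.unique (A : Type*) [Ring A] [Algebra K A] [FormalSeries W n K A]
    [LawfulPair A B] {a : Fin n → B} {δ δ' : Module.End K⟦X⟧ B}
    (h : IsVectorField a δ) (h' : IsVectorField a δ') : δ = δ' := by
  obtain ⟨P, rfl⟩ := exists_toEnd_eq A δ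
  obtain ⟨Q, rfl⟩ := exists_toEnd_eq A δ'
  congr 1
  ext1 k
  refine (isDerivation_coeff ((isDerivation_toEnd_iff P).1 h.1) k).ext_var
    (isDerivation_coeff ((isDerivation_toEnd_iff Q).1 h'.1) k) fun i => ?_
  rw [coeff_apply_var (B := B), coeff_apply_var (B := B), h.2, h'.2]

variable (B) in
theorem act_injective {α : ℕ} {P Q : (diffOp K A α)⟦X⟧} (h : ∀ u : B, act P u = act Q u) :
    P = Q := by
  have : opHom (endSeries P) =
      opHom (endSeries Q) := LinearMap.ext fun u => by
    have := congrArg (tExpansion A B) (h ((tExpansion A B).symm u))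
    rwa [tExpansion_act, tExpansion_act, RingEquiv.apply_symm_apply] at this
  exact endSeries_injective (opHom_injective this)

variable [Algebra ℚ K]

theorem tExpansion_rat_smul (q : ℚ) (u : B) :
    tExpansion A B (algebraMap ℚ K⟦X⟧ q • u) = algebraMap ℚ K q • tExpansion A B u := by
  have : algebraMap ℚ K⟦X⟧ q = C (algebraMap ℚ K q) :=
    PowerSeries.algebraMap_apply
  ext k
  rw [this, tExpansion_smul, map_C, coeff_C_mul, coeff_base_smul, Algebra.smul_def]

/-- Since P is divisible by t, the coefficient of t ^ k is stationary once N > k, for every monomial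
w at once. -/
theorem isExpApply_toEnd_iff {P : (Module.End K A)⟦X⟧} (hP : coeff 0 P = 0) {u v : B} :
    IsExpApply (toEnd B P) u v ↔ tExpansion A B v = opHom (expSeries K P) (tExpansion A B u) := by
  have hg := isGradedFamily_smul_pow hP (invFactorial K)
  have key : ∀ w k N, k < N → coeff k (coeffs (∑ j ∈ Finset.range N,
      algebraMap ℚ K⟦X⟧ ((j ! : ℚ)⁻¹) • (toEnd B P ^ j) u) w) =
      coeffs (coeff k (opHom (expSeries K P) (tExpansion A B u))) w := by
    intro w k N hN
    rw [← coeffs_tCoeff (A := A), ← coeff_tExpansion, map_sum, expSeries, hg.opHom_limSum,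
      (hg.opHom_apply _).coeff_limSum hN]
    simp only [tExpansion_rat_smul, tExpansion_toEnd_pow, opHom_base_smul, LinearMap.smul_apply]
    rfl
  constructor
  · intro h
    ext k
    apply coeffs.injective
    funext w
    obtain ⟨N, hN, hk⟩ := ((h w k).and (Filter.eventually_gt_atTop k)).exists
    rw [coeff_tExpansion, coeffs_tCoeff, ← hN, key w k N hk]
  · intro h w k
    filter_upwards [Filter.eventually_gt_atTop k] with N hN
    rw [key w k N hN, ← h, coeff_tExpansion, coeffs_tCoeff]

end

end FormalSeries

/-! ### The logarithm of an automorphism and its 5-tuple. -/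

namespace FormalSeries

open PowerSeries NCSTuple

section

variable {W : Type} {n : ℕ} {K A B : Type*} [CommRing K] [Algebra ℚ K]
  [Ring A] [Algebra K A] [FormalSeries W n K A]
  [Ring B] [Algebra K⟦X⟧ B] [FormalSeries W n K⟦X⟧ B] [LawfulPair A B]

theorem tCoeff_map_var {α : ℕ} {F : B ≃ₐ[K⟦X⟧] B} (hF : F ∈ autGE B α) (i : Fin n) (k : ℕ) :
    (k = 0 → tCoeff A k (F (var i)) = var i) ∧ (k ≠ 0 → OrderGE α (tCoeff A k (F (var i)))) := by
  have h := tCoeff_add (A := A) k (serH F i) (F (var i))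
  rw [serH, sub_add_cancel, LawfulPair.tCoeff_var] at h
  constructor
  · rintro rfl
    rw [if_pos rfl, ← serH, vanishesAtZero_iff_tCoeff.1 (hF i).2, zero_add] at h
    exact h.symm
  · intro hk
    rw [if_neg hk, ← serH] at h
    rw [eq_neg_of_add_eq_zero_right h.symm]
    exact (orderSubmodule K A α).neg_mem (orderGE_iff_tCoeff.1 (hF i).1 k)

theorem exists_toEnd_expSeries (A : Type*) [Ring A] [Algebra K A] [FormalSeries W n K A]
    [LawfulPair A B] {α : ℕ} (hα : 1 ≤ α) {F : B ≃ₐ[K⟦X⟧] B} (hF : F ∈ autGE B α) :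
    ∃ D : (Module.End K A)⟦X⟧, coeff 0 D = 0 ∧ (∀ k, coeff k D ∈ derGE K A α) ∧
      toEnd B (expSeries K D) = F.toLinearMap := by
  obtain ⟨P, hP⟩ := exists_toEnd_eq A F.toLinearMap
  have hPF : ∀ u, opHom P (tExpansion A B u) = tExpansion A B (F u) := fun u => by
    rw [← tExpansion_toEnd, hP]
    rfl
  have hmul : IsMultiplicative (opHom P) := by
    intro u v
    obtain ⟨u, rfl⟩ := (tExpansion A B).surjective u
    obtain ⟨v, rfl⟩ := (tExpansion A B).surjective v
    rw [← map_mul (tExpansion A B), hPF, hPF, hPF, map_mul F, map_mul (tExpansion A B)]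
  have hvar : ∀ k i, coeff k P (var i) = tCoeff A k (F (var i)) := fun k i => by
    rw [coeff_apply_var (B := B), hP]
    rfl
  -- At t = 0 the operator is multiplicative, unital and fixes the variables.
  have hP0 : coeff 0 P = 1 := by
    refine eq_one_of_var (isMultiplicative_coeff_zero hmul) ?_ fun i => ?_
    · have := hPF 1
      rw [map_one (tExpansion A B), map_one F, map_one (tExpansion A B)] at this
      have h0 := congrArg (coeff 0) this
      rw [← map_one C, coeff_opHom_C, coeff_C, if_pos rfl] at h0
      exact h0
    · rw [hvar, (tCoeff_map_var hF i 0).1 rfl]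
  obtain ⟨D, hD0, rfl⟩ := exists_expSeries_eq (K := K) hP0
  refine ⟨D, hD0, fun k => ?_, hP⟩
  refine coeff_mem_derGE_of_expSeries hD0 hmul (fun k hk i => ?_) k
  rw [hvar, Nat.sub_add_cancel hα]
  exact (tCoeff_map_var hF i k).2 hk

/-- The 5-tuple with logarithm `d = -D`. -/
noncomputable def omegaOfLog {R : Type*} (K : Type*) [CommRing K] [Algebra ℚ K] [Ring R]
    [Algebra K R] (D : R⟦X⟧) : NCSTuple R where
  f := negT (expSeries K D)
  g := expSeries K (-D)
  d := -D
  h := expSeries K D * ddt (expSeries K (-D))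
  m := ddt (expSeries K (-D)) * expSeries K D

theorem isNCSSystem_omegaOfLog {R : Type*} [Ring R] [Algebra K R] {D : R⟦X⟧}
    (hD : coeff 0 D = 0) : (omegaOfLog K D).IsNCSSystem K where
  f_zero := by
    rw [omegaOfLog, coeff_negT, coeff_zero_expSeries, pow_zero, one_mul]
  f_neg_mul_g := by
    rw [omegaOfLog, negT_negT, expSeries_mul_expSeries_neg hD]
  g_mul_f_neg := by
    rw [omegaOfLog, negT_negT, expSeries_neg_mul_expSeries hD]
  exp_d := (isExp_iff (by rw [omegaOfLog, map_neg, hD, neg_zero])).2 rfl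
  ddt_g_eq_g_mul_h := by
    rw [omegaOfLog, ← mul_assoc, expSeries_neg_mul_expSeries hD, one_mul]
  ddt_g_eq_m_mul_g := by
    rw [omegaOfLog, mul_assoc, expSeries_mul_expSeries_neg hD, mul_one]

theorem toEnd_apply_toEnd {P Q : (Module.End K A)⟦X⟧} (h : P * Q = 1) (u : B) :
    toEnd B P (toEnd B Q u) = u := by
  apply (tExpansion A B).injective
  rw [tExpansion_toEnd, tExpansion_toEnd, ← Module.End.mul_apply, ← map_mul, h, map_one,
    Module.End.one_apply]

theorem toEnd_mul_apply (P Q : (Module.End K A)⟦X⟧) (u : B) :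
    toEnd B (P * Q) u = toEnd B P (toEnd B Q u) := by
  apply (tExpansion A B).injective
  rw [tExpansion_toEnd, tExpansion_toEnd, tExpansion_toEnd, map_mul, Module.End.mul_apply]

theorem toEnd_neg_apply (P : (Module.End K A)⟦X⟧) (u : B) : toEnd B (-P) u = -toEnd B P u := by
  apply (tExpansion A B).injective
  rw [tExpansion_toEnd, map_neg (tExpansion A B), tExpansion_toEnd, map_neg (opHom (K := K) (A := A)),
    LinearMap.neg_apply]

theorem partialT_toEnd (P : (Module.End K A)⟦X⟧) (u : B) :
    partialT (toEnd B P u) = toEnd B (ddt P) u + toEnd B P (partialT u) := by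
  apply (tExpansion A B).injective
  rw [tExpansion_partialT, map_add, tExpansion_toEnd, tExpansion_toEnd, tExpansion_toEnd,
    tExpansion_partialT, ddt_opHom]

theorem partialT_sub (A : Type*) [Ring A] [Algebra K A] [FormalSeries W n K A]
    [LawfulPair A B] (u v : B) : partialT (u - v) = partialT u - partialT v := by
  apply (tExpansion A B).injective
  rw [tExpansion_partialT, map_sub, map_sub, tExpansion_partialT, tExpansion_partialT, ddt_sub]

theorem partialT_var (A : Type*) [Ring A] [Algebra K A] [FormalSeries W n K A]
    [LawfulPair A B] (i : Fin n) : partialT (var i : B) = 0 := by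
  apply (tExpansion A B).injective
  rw [tExpansion_partialT, tExpansion_var, ddt_C, map_zero]

theorem act_eq_toEnd {α : ℕ} (P : (diffOp K A α)⟦X⟧) (u : B) : act P u =
    toEnd B (endSeries P) u := by
  apply (tExpansion A B).injective
  rw [tExpansion_act, tExpansion_toEnd]

/-- The facts about `e ^ D` that make `omegaOfLog` satisfy its defining equations, for a series `D`
of derivations that is the logarithm of `F`. -/
structure IsLog (F : B ≃ₐ[K⟦X⟧] B) (s : ℕ) (D : (Module.End K A)⟦X⟧) : Prop where
  coeff_zero : coeff 0 D = 0
  isDerivation : IsDerivation (opHom D)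
  mem_raising : ∀ k, coeff k D ∈ raising K A s
  exp_apply : ∀ u, toEnd B (expSeries K D) u = F u

namespace IsLog

variable {F : B ≃ₐ[K⟦X⟧] B} {s : ℕ} {D : (Module.End K A)⟦X⟧}

theorem exp_mul_exp_neg (h : IsLog F s D) : expSeries K D * expSeries K (-D) = 1 :=
  expSeries_mul_expSeries_neg h.coeff_zero

theorem exp_neg_mul_exp (h : IsLog F s D) : expSeries K (-D) * expSeries K D = 1 :=
  expSeries_neg_mul_expSeries h.coeff_zero

theorem symm (h : IsLog F s D) : IsLog F.symm s (-D) where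
  coeff_zero := by rw [map_neg, h.coeff_zero, neg_zero]
  isDerivation u v := by
    rw [map_neg (opHom (K := K) (A := A)), LinearMap.neg_apply, h.isDerivation,
      LinearMap.neg_apply, LinearMap.neg_apply, neg_mul, mul_neg, neg_add]
  mem_raising k l u hu := by
    rw [map_neg, LinearMap.neg_apply]
    exact (orderSubmodule K A _).neg_mem (h.mem_raising k l u hu)
  exp_apply u := by
    apply F.injective
    rw [F.apply_symm_apply, ← h.exp_apply,
      toEnd_apply_toEnd h.exp_mul_exp_neg]

theorem isMultiplicative (h : IsLog F s D) : IsMultiplicative (opHom (expSeries K D)) :=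
  isMultiplicative_expSeries h.coeff_zero h.isDerivation

theorem isDLog {α : ℕ} (hα : 1 ≤ α) (h : IsLog F (α - 1) D) :
    IsDLog α F (fun i => toEnd B D (var i)) (toEnd B D) where
  vanishes i := by
    rw [vanishesAtZero_iff_tCoeff (A := A), ← coeff_apply_var, h.coeff_zero, LinearMap.zero_apply]
  order i := by
    rw [orderGE_iff_tCoeff (A := A)]
    intro k
    rw [← coeff_apply_var]
    exact (h.mem_raising k _ _ (LawfulSeries.orderGE_var i)).mono (by omega)
  vectorField := ⟨(isDerivation_toEnd_iff _).2 h.isDerivation, fun _ => rfl⟩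
  exp i := by
    rw [isExpApply_toEnd_iff h.coeff_zero, ← h.exp_apply, tExpansion_toEnd]

theorem isDerivation_exp_mul_ddt (h : IsLog F s D) :
    IsDerivation (opHom (expSeries K D * ddt (expSeries K (-D)))) :=
  isDerivation_opHom_mul_ddt h.isMultiplicative h.symm.isMultiplicative
    h.exp_mul_exp_neg

theorem isDerivation_ddt_mul_exp (h : IsLog F s D) :
    IsDerivation (opHom (ddt (expSeries K (-D)) * expSeries K D)) :=
  isDerivation_opHom_ddt_mul h.isMultiplicative h.symm.isMultiplicative
    h.exp_neg_mul_exp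

/-- As z_i does not depend on t, differentiating G(z_i) only hits the operator: ∂M_t/∂t is g'
applied to z, and F acts as e^D. -/
theorem isVectorField_exp_mul_ddt (h : IsLog F s D) :
    IsVectorField (fun i => F (partialT (serM F i)))
      (toEnd B (expSeries K D * ddt (expSeries K (-D)))) := by
  refine ⟨(isDerivation_toEnd_iff _).2 h.isDerivation_exp_mul_ddt, fun i => ?_⟩
  change _ = F (partialT (F.symm (var i) - var i))
  rw [toEnd_mul_apply, h.exp_apply, ← h.symm.exp_apply, partialT_sub A, partialT_toEnd,
    partialT_var A, map_zero, add_zero, sub_zero]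

theorem isVectorField_ddt_mul_exp (h : IsLog F s D) :
    IsVectorField (fun i => F.symm (partialT (serH F i)))
      (toEnd B (ddt (expSeries K (-D)) * expSeries K D)) := by
  refine ⟨(isDerivation_toEnd_iff _).2 h.isDerivation_ddt_mul_exp, fun i => ?_⟩
  -- Differentiating g(F(z_i)) = z_i gives g'(F(z_i)) + g(∂F(z_i)/∂t) = 0; the sign is absorbed by H
  -- = z - F.
  have h0 := partialT_toEnd (expSeries K (-D)) (toEnd B (expSeries K D) (var i))
  rw [toEnd_apply_toEnd h.exp_neg_mul_exp, partialT_var A] at h0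
  change _ = F.symm (partialT (var i - F (var i)))
  rw [toEnd_mul_apply, ← h.symm.exp_apply, partialT_sub A, partialT_var A, zero_sub,
    map_neg, ← h.exp_apply]
  exact eq_neg_of_add_eq_zero_left h0.symm

theorem coeff_exp_mul_ddt_mem (h : IsLog F s D) (k : ℕ) :
    coeff k (expSeries K D * ddt (expSeries K (-D))) ∈ raising K A s := by
  have h' := h.symm.mem_raising
  exact coeff_mul_mem_raising (coeff_expSeries_mem_raising_zero h.mem_raising)
      (coeff_ddt_expSeries_mem_raising h') _ (by omega) k

theorem coeff_ddt_mul_exp_mem (h : IsLog F s D) (k : ℕ) :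
    coeff k (ddt (expSeries K (-D)) * expSeries K D) ∈ raising K A s := by
  have h' := h.symm.mem_raising
  exact coeff_mul_mem_raising (coeff_ddt_expSeries_mem_raising h')
      (coeff_expSeries_mem_raising_zero h.mem_raising) _ (by omega) k

/-- The tuple lives over the subalgebra, while its properties are checked in `Module.End K A`;
`endSeries` commutes with exponentials, products and d/dt. -/
theorem isOmega {α : ℕ} (hα : 1 ≤ α) {D : (diffOp K A α)⟦X⟧}
    (h : IsLog F (α - 1) (endSeries D)) : IsOmega α F (omegaOfLog K D) := by
  have hneg : endSeries (expSeries K (-D)) = expSeries K (-endSeries D) := by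
    rw [endSeries_expSeries, map_neg]
  have hh : endSeries (omegaOfLog K D).h =
      expSeries K (endSeries D) * ddt (expSeries K (-endSeries D)) := by
    rw [omegaOfLog, map_mul, endSeries_ddt, hneg, endSeries_expSeries]
  have hm : endSeries (omegaOfLog K D).m =
      ddt (expSeries K (-endSeries D)) * expSeries K (endSeries D) := by
    rw [omegaOfLog, map_mul, endSeries_ddt, hneg, endSeries_expSeries]
  have hd : endSeries (omegaOfLog K D).d = -endSeries D := map_neg _ _
  constructor
  · intro u
    rw [act_eq_toEnd, omegaOfLog, negT_negT, endSeries_expSeries, h.exp_apply]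
  · intro u
    rw [act_eq_toEnd, omegaOfLog, hneg, h.symm.exp_apply]
  · exact ⟨_, _, h.isDLog hα, fun u => by rw [act_eq_toEnd, hd, toEnd_neg_apply]⟩
  · intro k
    rw [← coeff_endSeries, hd]
    exact ⟨isDerivation_coeff h.symm.isDerivation k, h.symm.mem_raising k⟩
  · exact ⟨_, h.isVectorField_exp_mul_ddt, fun u => by rw [act_eq_toEnd, hh]⟩
  · intro k
    rw [← coeff_endSeries, hh]
    exact ⟨isDerivation_coeff h.isDerivation_exp_mul_ddt k, h.coeff_exp_mul_ddt_mem k⟩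
  · exact ⟨_, h.isVectorField_ddt_mul_exp, fun u => by rw [act_eq_toEnd, hm]⟩
  · intro k
    rw [← coeff_endSeries, hm]
    exact ⟨isDerivation_coeff h.isDerivation_ddt_mul_exp k, h.coeff_ddt_mul_exp_mem k⟩

end IsLog

theorem IsDLog.unique (A : Type*) [Ring A] [Algebra K A] [FormalSeries W n K A]
    [LawfulPair A B] {α : ℕ} {F : B ≃ₐ[K⟦X⟧] B} {a a' : Fin n → B} {δ δ' : Module.End K⟦X⟧ B}
    (h : IsDLog α F a δ) (h' : IsDLog α F a' δ') : δ = δ' := by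
  have key : ∀ (P : (Module.End K A)⟦X⟧) (b : Fin n → B), IsDLog α F b (toEnd B P) →
      coeff 0 P = 0 ∧ IsMultiplicative (opHom (expSeries K P)) ∧
      ∀ k i, coeff k (expSeries K P) (var i) = tCoeff A k (F (var i)) := by
    intro P b hb
    have hder := (isDerivation_toEnd_iff P).1 hb.vectorField.1
    -- Vanishing of the D-Log at t = 0 makes the constant coefficient a derivation killing the
    -- variables, so exponentials of P make sense.
    have h0 : coeff 0 P = 0 := (isDerivation_coeff hder 0).eq_zero_of_var fun i => by
      rw [coeff_apply_var (B := B), hb.vectorField.2]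
      exact vanishesAtZero_iff_tCoeff.1 (hb.vanishes i)
    refine ⟨h0, isMultiplicative_expSeries h0 hder, fun k i => ?_⟩
    rw [← coeff_tExpansion, (isExpApply_toEnd_iff h0).1 (hb.exp i), tExpansion_var, coeff_opHom_C]
  obtain ⟨P, rfl⟩ := exists_toEnd_eq A δ
  obtain ⟨Q, rfl⟩ := exists_toEnd_eq A δ'
  obtain ⟨hP0, hP, hPv⟩ := key P a h
  obtain ⟨hQ0, hQ, hQv⟩ := key Q a' h'
  congr 1
  refine expSeries_injective (K := K) hP0 hQ0 (opHom_ext_var hP hQ (coeff_zero_expSeries _)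
    (coeff_zero_expSeries _) fun k i => ?_)
  rw [hPv, hQv]

theorem IsOmega.unique {α : ℕ} {F : B ≃ₐ[K⟦X⟧] B} {Ω Ω' : NCSTuple (diffOp K A α)}
    (h : IsOmega α F Ω) (h' : IsOmega α F Ω') : Ω = Ω' := by
  have hf : Ω.f = Ω'.f := by
    rw [← negT_negT Ω.f, ← negT_negT Ω'.f]
    congr 1
    exact act_injective B fun u => by rw [h.f_spec, h'.f_spec]
  have hg : Ω.g = Ω'.g := act_injective B fun u => by rw [h.g_spec, h'.g_spec]
  have hd : Ω.d = Ω'.d := by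
    obtain ⟨a, δ, hδ, hu⟩ := h.d_spec
    obtain ⟨a', δ', hδ', hu'⟩ := h'.d_spec
    exact act_injective B fun u => by rw [hu, hu', hδ.unique A hδ']
  have hh : Ω.h = Ω'.h := by
    obtain ⟨δ, hδ, hu⟩ := h.h_spec
    obtain ⟨δ', hδ', hu'⟩ := h'.h_spec
    exact act_injective B fun u => by rw [hu, hu', hδ.unique A hδ']
  have hm : Ω.m = Ω'.m := by
    obtain ⟨δ, hδ, hu⟩ := h.m_spec
    obtain ⟨δ', hδ', hu'⟩ := h'.m_spec
    exact act_injective B fun u => by rw [hu, hu', hδ.unique A hδ']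
  cases Ω
  cases Ω'
  simp_all

theorem existsUnique_isOmega_and_isNCSSystem (A : Type*) [Ring A] [Algebra K A]
    [FormalSeries W n K A] [LawfulPair A B] {α : ℕ} (hα : 1 ≤ α) {F : B ≃ₐ[K⟦X⟧] B}
    (hF : F ∈ autGE B α) :
    (∃! Ω : NCSTuple (diffOp K A α), IsOmega α F Ω) ∧
      ∀ Ω : NCSTuple (diffOp K A α), IsOmega α F Ω → Ω.IsNCSSystem K := by
  obtain ⟨D, hD0, hD, hDF⟩ := exists_toEnd_expSeries A hα hF
  -- The coefficients of D are generators of `diffOp K A α`, so everything built from D has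
  -- coefficients in that algebra.
  let D' : (diffOp K A α)⟦X⟧ := PowerSeries.mk fun k => ⟨coeff k D, Algebra.subset_adjoin (hD k)⟩
  have hmap : endSeries D' = D := by
    ext1 k
    rw [coeff_endSeries, coeff_mk]
  have hD'0 : coeff 0 D' = 0 := by
    rw [coeff_mk]
    exact Subtype.ext hD0
  have hlog : IsLog F (α - 1) (endSeries D') := by
    rw [hmap]
    exact ⟨hD0, isDerivation_opHom fun k => (hD k).1, fun k => (hD k).2,
      fun u => by rw [hDF]; rfl⟩
  have hΩ := hlog.isOmega hα
  refine ⟨⟨_, hΩ, fun Ω h => h.unique hΩ⟩, fun Ω h => ?_⟩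
  rw [h.unique hΩ]
  exact isNCSSystem_omegaOfLog hD'0

end

end FormalSeries

/-! ### The two concrete models. -/

namespace FormalSeries

section Noncommutative

variable {n : ℕ} {K : Type*} [CommRing K]

theorem _root_.NCPowerSeries.coeffs_eq {R : Type*} [CommRing R] (u : NCPowerSeries (Fin n) R)
    (w : List (Fin n)) : coeffs u w = u w := rfl

theorem _root_.NCPowerSeries.sum_apply {R : Type*} [CommRing R] {ι : Type*} (s : Finset ι)
    (f : ι → NCPowerSeries (Fin n) R) (w : List (Fin n)) : (∑ i ∈ s, f i) w = ∑ i ∈ s, f i w :=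
  Finset.sum_apply w s f

theorem _root_.NCPowerSeries.X_mul_cons {R : Type*} [CommRing R] (i a : Fin n)
    (u : NCPowerSeries (Fin n) R) (w : List (Fin n)) :
    (NCPowerSeries.X i * u : NCPowerSeries (Fin n) R) (a :: w) = if a = i then u w else 0 := by
  have : NCPowerSeries.tail a (NCPowerSeries.X i : NCPowerSeries (Fin n) R) =
      if a = i then 1 else 0 := by
    funext w
    split_ifs with h <;> cases w <;> simp [NCPowerSeries.tail, NCPowerSeries.X, h,
      NCPowerSeries.one_nil, NCPowerSeries.zero_apply]
    rfl
  rw [NCPowerSeries.mul_cons, this]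
  split_ifs <;> simp [NCPowerSeries.X, NCPowerSeries.zero_apply]

instance : LawfulPair (NCPowerSeries (Fin n) K) (NCPowerSeries (Fin n) K⟦X⟧) where
  coeffs_add _ _ _ := rfl
  coeffs_smul _ _ _ := rfl
  orderGE_mul {k l u v} hu hv w hw := by
    rw [NCPowerSeries.coeffs_eq, NCPowerSeries.mul_apply]
    refine Finset.sum_eq_zero fun i hi => ?_
    rw [Finset.mem_range] at hi
    change w.length < k + l at hw
    rcases lt_or_ge i k with h | h
    · rw [← NCPowerSeries.coeffs_eq u, hu _ (by
        change (w.take i).length < k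
        rw [List.length_take]
        omega), zero_mul]
    · rw [← NCPowerSeries.coeffs_eq v, hv _ (by
        change (w.drop i).length < l
        rw [List.length_drop]
        omega), mul_zero]
  orderGE_var i w hw := by
    change w.length < 1 at hw
    have : w = [] := List.length_eq_zero_iff.1 (by omega)
    subst this
    rfl
  exists_eq_add_sum u := by
    -- Nonempty words are sorted by their first letter.
    refine ⟨u [], fun i => NCPowerSeries.tail i u, ?_, fun k hk i w hw => ?_⟩
    · funext w
      rw [NCPowerSeries.add_apply, NCPowerSeries.smul_apply, NCPowerSeries.sum_apply]
      change u w = _ + ∑ i, (NCPowerSeries.X i * NCPowerSeries.tail i u : NCPowerSeries (Fin n) K) w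
      cases w with
      | nil => simp [NCPowerSeries.one_nil, NCPowerSeries.mul_nil, NCPowerSeries.X]
      | cons a w =>
        simp only [NCPowerSeries.X_mul_cons, Finset.sum_ite_eq, Finset.mem_univ, if_true]
        change u (a :: w) = u [] * 0 + u (a :: w)
        rw [mul_zero, zero_add]
    · exact hk (i :: w) (Nat.succ_lt_succ hw)
  deg_eq _ := rfl
  coeffs_add' _ _ _ := rfl
  coeffs_smul' _ _ _ := rfl
  tCoeff_mul k u v := by
    funext w
    rw [NCPowerSeries.sum_apply]
    change PowerSeries.coeff k ((u * v) w) = _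
    simp only [NCPowerSeries.mul_apply, map_sum, PowerSeries.coeff_mul]
    rw [Finset.sum_comm]
    rfl
  tCoeff_var k i := by
    funext w
    change PowerSeries.coeff k (if w = [i] then 1 else 0) = _
    split_ifs with h1 h2 h2
    · subst h1 h2
      simp [var, NCPowerSeries.X]
    · rw [PowerSeries.coeff_one, if_neg h2]
      rfl
    · rw [map_zero]
      exact (if_neg h1).symm
    · rw [map_zero]
      rfl

end Noncommutative

section Commutative

variable {n : ℕ} {K : Type*} [CommRing K]

theorem _root_.MvPowerSeries.coeffs_eq {R : Type*} [CommRing R] (u : MvPowerSeries (Fin n) R)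
    (w : Fin n →₀ ℕ) : coeffs u w = MvPowerSeries.coeff w u := rfl

/-- The part of `u` whose monomials have first variable `i`, divided by the variable `i`. -/
noncomputable def firstVarQuotient {R : Type*} [CommRing R] (i : Fin n)
    (u : MvPowerSeries (Fin n) R) : MvPowerSeries (Fin n) R :=
  fun w => if ∀ j < i, w j = 0 then MvPowerSeries.coeff (w + Finsupp.single i 1) u else 0

theorem coeff_firstVarQuotient {R : Type*} [CommRing R] (i : Fin n)
    (u : MvPowerSeries (Fin n) R) (w : Fin n →₀ ℕ) :
    MvPowerSeries.coeff w (firstVarQuotient i u) =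
      if ∀ j < i, w j = 0 then MvPowerSeries.coeff (w + Finsupp.single i 1) u else 0 := rfl

theorem coeff_X_mul_firstVarQuotient {R : Type*} [CommRing R] (i : Fin n)
    (u : MvPowerSeries (Fin n) R) (w : Fin n →₀ ℕ) :
    MvPowerSeries.coeff w (MvPowerSeries.X i * firstVarQuotient i u) =
      if w i ≠ 0 ∧ ∀ j < i, w j = 0 then MvPowerSeries.coeff w u else 0 := by
  rw [MvPowerSeries.X, MvPowerSeries.coeff_monomial_mul]
  by_cases h : w i = 0
  · rw [if_neg, if_neg (by tauto)]
    intro hle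
    have := hle i
    simp [h] at this
  · have hle : Finsupp.single i 1 ≤ w := by
      rw [Finsupp.single_le_iff]
      omega
    rw [if_pos hle, one_mul, coeff_firstVarQuotient, tsub_add_cancel_of_le hle]
    refine if_congr ?_ rfl rfl
    refine ⟨fun hj => ⟨h, fun j hji => ?_⟩, fun hj j hji => ?_⟩
    · have := hj j hji
      rwa [Finsupp.tsub_apply, Finsupp.single_eq_of_ne hji.ne, tsub_zero] at this
    · rw [Finsupp.tsub_apply, hj.2 j hji, zero_tsub]

/-- Each nonconstant monomial is assigned to its variable of least index, so exactly one summand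
contains it. -/
theorem eq_add_sum_X_mul_firstVarQuotient {R : Type*} [CommRing R]
    (u : MvPowerSeries (Fin n) R) :
    u = MvPowerSeries.coeff 0 u • 1 + ∑ i, MvPowerSeries.X i * firstVarQuotient i u := by
  ext w
  rw [map_add, map_sum, MvPowerSeries.coeff_smul, MvPowerSeries.coeff_one]
  simp only [coeff_X_mul_firstVarQuotient]
  by_cases hw : w = 0
  · subst hw
    simp
  · rw [if_neg hw, mul_zero, zero_add]
    have hs : w.support.Nonempty := Finsupp.support_nonempty_iff.2 hw
    set a := w.support.min' hs with ha
    have ha0 : w a ≠ 0 := Finsupp.mem_support_iff.1 (w.support.min'_mem hs)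
    have hlt : ∀ j < a, w j = 0 := fun j hj => by
      by_contra h
      exact absurd (w.support.min'_le j (Finsupp.mem_support_iff.2 h)) (not_le.2 hj)
    rw [Finset.sum_eq_single a, if_pos ⟨ha0, hlt⟩]
    · intro i _ hi
      refine if_neg fun h => ?_
      rcases lt_or_gt_of_ne hi with h' | h'
      · exact h.1 (hlt i h')
      · exact ha0 (h.2 a h')
    · intro h
      exact absurd (Finset.mem_univ a) h

instance : LawfulPair (MvPowerSeries (Fin n) K) (MvPowerSeries (Fin n) K⟦X⟧) where
  coeffs_add _ _ _ := rfl
  coeffs_smul _ _ _ := rfl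
  orderGE_mul {k l u v} hu hv w hw := by
    classical
    rw [MvPowerSeries.coeffs_eq, MvPowerSeries.coeff_mul]
    refine Finset.sum_eq_zero fun x hx => ?_
    rw [Finset.HasAntidiagonal.mem_antidiagonal] at hx
    change w.degree < k + l at hw
    rw [← hx, map_add] at hw
    rcases lt_or_ge x.1.degree k with h | h
    · rw [← MvPowerSeries.coeffs_eq u, hu _ h, zero_mul]
    · rw [← MvPowerSeries.coeffs_eq v, hv _ (by change x.2.degree < l; omega), mul_zero]
  orderGE_var i w hw := by
    classical
    change w.degree < 1 at hw
    have : w = 0 := (Finsupp.degree_eq_zero_iff w).1 (by omega)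
    subst this
    change MvPowerSeries.coeff 0 (MvPowerSeries.X i) = 0
    simp
  exists_eq_add_sum u := by
    refine ⟨MvPowerSeries.coeff 0 u, fun i => firstVarQuotient i u,
      eq_add_sum_X_mul_firstVarQuotient u, fun k hk i w hw => ?_⟩
    rw [MvPowerSeries.coeffs_eq, coeff_firstVarQuotient]
    split_ifs
    · refine hk _ ?_
      change w.degree < k at hw
      change (w + Finsupp.single i 1).degree < k + 1
      rw [map_add, Finsupp.degree_single]
      omega
    · rfl
  deg_eq _ := rfl
  coeffs_add' _ _ _ := rfl
  coeffs_smul' _ _ _ := rfl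
  tCoeff_mul k u v := by
    classical
    ext w
    rw [map_sum]
    change PowerSeries.coeff k (MvPowerSeries.coeff w (u * v)) = _
    simp only [MvPowerSeries.coeff_mul, map_sum, PowerSeries.coeff_mul]
    rw [Finset.sum_comm]
    rfl
  tCoeff_var k i := by
    classical
    ext w
    change PowerSeries.coeff k (MvPowerSeries.coeff w (MvPowerSeries.X i)) =
      MvPowerSeries.coeff w (if k = 0 then MvPowerSeries.X i else 0)
    rw [MvPowerSeries.coeff_X]
    split_ifs with h1 h2 h2
    · subst h1 h2
      rw [MvPowerSeries.coeff_X, if_pos rfl, PowerSeries.coeff_one, if_pos rfl]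
    · rw [PowerSeries.coeff_one, if_neg h2, map_zero]
    · rw [map_zero, MvPowerSeries.coeff_X, if_neg h1]
    · rw [map_zero, map_zero]

end Commutative

end FormalSeries

theorem theorem3p11 {K : Type*} [CommRing K] [Algebra ℚ K] (n α : ℕ) (hα : 1 ≤ α) :
    -- commuting variables
    (∀ F ∈ FormalSeries.autGE (K := K) (MvPowerSeries (Fin n) K⟦X⟧) α,
      (∃! Ω : NCSTuple (FormalSeries.diffOp K (MvPowerSeries (Fin n) K) α),
        FormalSeries.IsOmega α F Ω) ∧
      ∀ Ω : NCSTuple (FormalSeries.diffOp K (MvPowerSeries (Fin n) K) α),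
        FormalSeries.IsOmega α F Ω → Ω.IsNCSSystem K) ∧
    -- noncommuting variables
    (∀ F ∈ FormalSeries.autGE (K := K) (NCPowerSeries (Fin n) K⟦X⟧) α,
      (∃! Ω : NCSTuple (FormalSeries.diffOp K (NCPowerSeries (Fin n) K) α),
        FormalSeries.IsOmega α F Ω) ∧
      ∀ Ω : NCSTuple (FormalSeries.diffOp K (NCPowerSeries (Fin n) K) α),
        FormalSeries.IsOmega α F Ω → Ω.IsNCSSystem K) := by
  exact ⟨fun _ hF => FormalSeries.existsUnique_isOmega_and_isNCSSystem _ hα hF,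
    fun _ hF => FormalSeries.existsUnique_isOmega_and_isNCSSystem _ hα hF⟩
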